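/- An igraph $C$ on a finite set $V$ is the complete graph on $V$ with each edge coloured red, blue or green. Let $C_r$ be the graph of edges that are red or green and $C_b$ the graph of edges that are blue or green. For $p\in(0,1)$ the $p$-weight of $C$ is $w_p(C)=p|C_r|+(1-p)|C_b|$, where $|\cdot|$ denotes the number of edges. We say that $C$ contains a graph $H$ if there is an injection $f:V(H)\to V$ that maps edges of $H$ to edges of $C_r$ and edges of the complement $\overline H$ to edges of $C_b$; otherwise $C$ is $H$-free. Let $I_{a,b}=K_{a+b}\setminus K_b$, the graph obtained from the complete graph on $a+b$ vertices by deleting all edges inside a set of $b$ vertices. Let $B_a(n)$ be the igraph on $[n]$ (defined up to isomorphism) consisting of $a$ disjoint blue cliques, of sizes as equal as possible, with all edges between different cliques green; let $R_{b-1}(n)$ be the igraph on $[n]$ consisting of $b-1$ disjoint red cliques, of sizes as equal as possible, with all edges between different cliques green. **Theorem 1.3.** For all integers $a,b\ge 2$ and all $p\in(0,1)$ there is $n_0$ such that for every $n>n_0$, the igraphs that have maximum $p$-weight among the $I_{a,b}$-free igraphs on $[n]$ are, up to isomorphism (relabelling of vertices), exactly the following: - $R_{b-1}(n)$, if $p>\frac{a}{a+b-1}$,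 or $p=\frac{a}{a+b-1}$ and $a<b-1$; - $B_a(n)$, if $p<\frac{a}{a+b-1}$, or $p=\frac{a}{a+b-1}$ and $a>b-1$; - $R_{b-1}(n)$ and $B_a(n)$, if $p=\frac{a}{a+b-1}=\frac12$. -/

import Mathlib

open SimpleGraph

noncomputable section

/-- The three colours of the edges of an igraph. -/
inductive Colour where
  | red
  | blue
  | green

/-- An igraph on `V`: the edges of the complete graph on `V` are coloured red, blue or green. -/
abbrev Igraph (V : Type*) := TopEdgeLabeling V Colour

namespace Igraph

variable {V W : Type*}

/-- `C_r`, the graph of the pairs that are red in the two-coloured viewpoint: red or green. -/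
def redGraph (C : Igraph V) : SimpleGraph V :=
  C.labelGraph Colour.red ⊔ C.labelGraph Colour.green

/-- `C_b`, the graph of the pairs that are blue in the two-coloured viewpoint: blue or green. -/
def blueGraph (C : Igraph V) : SimpleGraph V :=
  C.labelGraph Colour.blue ⊔ C.labelGraph Colour.green

/-- The `p`-weight `w_p(C) = p |C_r| + (1 - p) |C_b|` of an igraph on a finite vertex set. -/
def weight [Finite V] (p : ℝ) (C : Igraph V) : ℝ :=
  p * (C.redGraph.edgeSet.ncard : ℝ) + (1 - p) * (C.blueGraph.edgeSet.ncard : ℝ)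

/-- `C` contains the graph `H`: the vertices of `H` can be identified with vertices of `C` so that
the edges of `H` lie in `C_r` and the edges of the complement of `H` lie in `C_b`. -/
def Contains (C : Igraph V) (H : SimpleGraph W) : Prop :=
  ∃ f : W ↪ V, H.map f ≤ C.redGraph ∧ Hᶜ.map f ≤ C.blueGraph

/-- `C` is `H`-free. -/
def IsFree (C : Igraph V) (H : SimpleGraph W) : Prop :=
  ¬ C.Contains H

/-- `C` has maximum `p`-weight among the `H`-free igraphs on its vertex set. -/
def IsExtremal [Finite V] (p : ℝ) (H : SimpleGraph W) (C : Igraph V) : Prop :=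
  C.IsFree H ∧ ∀ D : Igraph V, D.IsFree H → D.weight p ≤ C.weight p

/-- `C` and `D` are equal up to a relabelling of the vertices that preserves all colours. -/
def IsIsomorphic (C : Igraph V) (D : Igraph W) : Prop :=
  ∃ e : V ≃ W, TopEdgeLabeling.pullback D e.toEmbedding = C

/-- The igraph on `n` vertices that consists of `k` disjoint cliques of colour `c`, joined by green
edges, with clique sizes as equal as possible. The cliques are the residue classes modulo `k`, as in
Mathlib's `SimpleGraph.turanGraph`. -/
def balanced (c : Colour) (k n : ℕ) : Igraph (Fin n) :=
  EdgeLabeling.mk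
    (fun x y _ => if (x : ℕ) % k = (y : ℕ) % k then c else Colour.green)
    (fun x y _ => by simp only [eq_comm])

/-- `B_a(n)`: `a` balanced blue cliques joined by green edges. -/
def balancedBlue (a n : ℕ) : Igraph (Fin n) := balanced Colour.blue a n

/-- `R_k(n)`: `k` balanced red cliques joined by green edges. -/
def balancedRed (k n : ℕ) : Igraph (Fin n) := balanced Colour.red k n

end Igraph

/-- The `(a,b)`-eye `I_{a,b}`, the complete graph `K_{a+b}` minus the edges of a `K_b`. -/
def eyeGraph (a b : ℕ) : SimpleGraph (Fin a ⊕ Fin b) :=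
  ⊤ \ (⊤ : SimpleGraph (Fin b)).map (Function.Embedding.inr : Fin b ↪ Fin a ⊕ Fin b)

end

/-! Measure an igraph by what it loses against the all-green colouring: a blue pair loses p, a red
pair 1 - p. A vertex loses about (p/a) n in B_a(n) and about ((1-p)/(b-1)) n in R_{b-1}(n); let l be
the smaller coefficient. An eye consists of a vertices with no blue pair, b further vertices with no
red pair, and no blue pair between them.

The core is `exists_forall_eyeFree_not_indep`: in a large eye-free igraph where each vertex loses at
most (l + ε) n, C_r has no K_{a+1} or C_b has no K_b. Take a bounded set X of vertices of largest
red degree. If one of them has small red degree, almost all red degrees are small, so sets without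
red pairs are easy to find and a K_{a+1} in C_r would yield an eye. Otherwise Ramsey's theorem gives
inside X a large blue clique or a large clique of C_r. A blue clique is impossible: its vertices
spend part of their loss on red, so a greedy choice completes it to an eye. For a clique of C_r, a
failing greedy choice forces red degrees close to n/(b-1); this uses up the allowed loss, so blue
degrees there are O(ε n). Scarcity of blue spreads to every vertex, and then a K_b in C_b would
extend to an eye.

`exists_forall_isFree_weight_le` removes the degree condition by maximising a penalised weight over
vertex subsets, which satisfies the condition on the maximiser and then forces it to be everything.
Turán's theorem with its equality case gives the extremal igraphs, and an exact formula for Turán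
numbers decides which of the two families is heavier. -/

open scoped Classical in
/-- The neighbourhood of a vertex of a graph on a finite vertex set, as a finset. -/
noncomputable def nbh {V : Type*} [Fintype V] (G : SimpleGraph V) (v : V) : Finset V :=
  Finset.univ.filter (G.Adj v)

/-- No two vertices of the finset are adjacent. -/
def Indep {V : Type*} (G : SimpleGraph V) (S : Finset V) : Prop :=
  ∀ x ∈ S, ∀ y ∈ S, ¬ G.Adj x y

/-- Freeness of the `(a,b)`-eye, in terms of the graphs of red edges and of blue edges. -/
def EyeFree {V : Type*} (R B : SimpleGraph V) (a b : ℕ) : Prop :=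
  ∀ A S : Finset V, A.card = a → S.card = b → Disjoint A S → Indep B A → Indep R S →
    ∃ x ∈ A, ∃ y ∈ S, B.Adj x y

/-! ### Ramsey's theorem and greedy choices of independent sets. -/

section Combinatorics

open scoped Classical
open Finset

variable {V : Type*}

lemma Indep.mono {G : SimpleGraph V} {S T : Finset V} (h : Indep G T) (hST : S ⊆ T) :
    Indep G S := fun x hx y hy => h x (hST hx) y (hST hy)

lemma Indep.insert {G : SimpleGraph V} {S : Finset V} {v : V} (h : Indep G S)
    (hv : ∀ y ∈ S, ¬ G.Adj v y) : Indep G (insert v S) := by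
  intro x hx y hy
  rw [Finset.mem_insert] at hx hy
  rcases hx with rfl | hx <;> rcases hy with rfl | hy
  · exact G.loopless.irrefl _
  · exact hv y hy
  · exact fun h' => hv x hx h'.symm
  · exact h x hx y hy

/-- Ramsey's theorem for two colours. -/
theorem exists_clique_or_indep (G : SimpleGraph V) (s t : ℕ) (X : Finset V)
    (hX : 2 ^ (s + t) ≤ X.card) :
    (∃ S ⊆ X, S.card = s ∧ ∀ x ∈ S, ∀ y ∈ S, x ≠ y → G.Adj x y) ∨
      (∃ S ⊆ X, S.card = t ∧ Indep G S) := by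
  induction s generalizing t X with
  | zero => exact .inl ⟨∅, by simp⟩
  | succ s ihs =>
    induction t generalizing X with
    | zero => exact .inr ⟨∅, by simp [Indep]⟩
    | succ t iht =>
      have hpos : 0 < X.card := lt_of_lt_of_le (by positivity) hX
      obtain ⟨v, hv⟩ := Finset.card_pos.1 hpos
      have hsplit := card_filter_add_card_filter_not (s := X.erase v) (fun x => G.Adj v x)
      rw [card_erase_of_mem hv] at hsplit
      have h2 : 2 ^ (s + 1 + (t + 1)) = 2 * 2 ^ (s + (t + 1)) := by ring
      by_cases hc : 2 ^ (s + (t + 1)) ≤ #{x ∈ X.erase v | G.Adj v x}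
      · rcases ihs (t + 1) _ hc with ⟨S, hS, hcard, hcl⟩ | ⟨S, hS, hcard, hin⟩
        · left
          have hvS : v ∉ S := fun h => by have := hS h; simp at this
          refine ⟨insert v S, ?_, by rw [card_insert_of_notMem hvS, hcard], ?_⟩
          · intro x hx
            rcases mem_insert.1 hx with rfl | hx
            · exact hv
            · exact mem_of_mem_erase (mem_filter.1 (hS hx)).1
          · intro x hx y hy hxy
            rw [mem_insert] at hx hy
            rcases hx with rfl | hx <;> rcases hy with rfl | hy
            · exact absurd rfl hxy
            · exact (mem_filter.1 (hS hy)).2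
            · exact (mem_filter.1 (hS hx)).2.symm
            · exact hcl x hx y hy hxy
        · right
          exact ⟨S, fun x hx => mem_of_mem_erase (mem_filter.1 (hS hx)).1, hcard, hin⟩
      -- Without `v` at least 2 * 2^(s+t+1) - 1 vertices remain, so if one class falls short of
      -- 2^(s+t+1), the other reaches it.
      · have hc' : 2 ^ (s + 1 + t) ≤ #{x ∈ X.erase v | ¬ G.Adj v x} := by
          have : 2 ^ (s + 1 + t) = 2 ^ (s + (t + 1)) := by ring
          omega
        rcases iht _ hc' with ⟨S, hS, hcard, hcl⟩ | ⟨S, hS, hcard, hin⟩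
        · left
          exact ⟨S, fun x hx => mem_of_mem_erase (mem_filter.1 (hS hx)).1, hcard, hcl⟩
        · right
          have hvS : v ∉ S := fun h => by have := hS h; simp at this
          refine ⟨insert v S, ?_, by rw [card_insert_of_notMem hvS, hcard], ?_⟩
          · intro x hx
            rcases mem_insert.1 hx with rfl | hx
            · exact hv
            · exact mem_of_mem_erase (mem_filter.1 (hS hx)).1
          · exact hin.insert fun y hy => (mem_filter.1 (hS hy)).2

lemma card_sub_card_le_card_sdiff (s t : Finset V) : (#s : ℝ) - #t ≤ #(s \ t) := by
  have := le_card_sdiff t s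
  have h2 : #s ≤ #(s \ t) + #t := by omega
  have h3 : (#s : ℝ) ≤ #(s \ t) + #t := by exact_mod_cast h2
  linarith

lemma sum_card_filter_adj_comm (B : SimpleGraph V) (Y T : Finset V) :
    ∑ v ∈ Y, #{u ∈ T | B.Adj v u} = ∑ u ∈ T, #{v ∈ Y | B.Adj u v} := by
  simp_rw [card_filter]
  rw [sum_comm]
  simp_rw [B.adj_comm]

variable [Fintype V]

lemma mem_nbh {G : SimpleGraph V} {v w : V} : w ∈ nbh G v ↔ G.Adj v w := by simp [nbh]

lemma card_biUnion_nbh_le (G : SimpleGraph V) (S : Finset V) (D : ℝ)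
    (hD : ∀ v ∈ S, (#(nbh G v) : ℝ) ≤ D) : (#(S.biUnion (nbh G) ∪ S) : ℝ) ≤ #S * (D + 1) := by
  have h1 : #(S.biUnion (nbh G) ∪ S) ≤ (∑ v ∈ S, #(nbh G v)) + #S :=
    (card_union_le _ _).trans (Nat.add_le_add_right card_biUnion_le _)
  have h2 : (#(S.biUnion (nbh G) ∪ S) : ℝ) ≤ (∑ v ∈ S, (#(nbh G v) : ℝ)) + #S := by
    exact_mod_cast h1
  have h3 : (∑ v ∈ S, (#(nbh G v) : ℝ)) ≤ ∑ v ∈ S, D := sum_le_sum hD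
  rw [sum_const, nsmul_eq_mul] at h3
  linarith

/-- In a set that is large compared with the degrees of its vertices there are independent sets. -/
theorem exists_indep_subset (G : SimpleGraph V) (D : ℝ) (hD₀ : 0 ≤ D) (j : ℕ)
    (Y : Finset V)     (hD : ∀ v ∈ Y, (#(nbh G v) : ℝ) ≤ D) (hY : j * (D + 1) < #Y) :
    ∃ S ⊆ Y, #S = j + 1 ∧ Indep G S := by
  induction j generalizing Y with
  | zero =>
    obtain ⟨v, hv⟩ : Y.Nonempty := card_pos.1 (by exact_mod_cast (by simpa using hY))
    exact ⟨{v}, by simpa using hv, by simp, by simp [Indep]⟩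
  | succ j ih =>
    have hne : Y.Nonempty := by
      rw [← card_pos, ← Nat.cast_pos (α := ℝ)]
      exact lt_of_le_of_lt (by positivity) hY
    obtain ⟨v, hv⟩ := hne
    have hcard := card_sub_card_le_card_sdiff Y (insert v (nbh G v))
    have h1 : (#(insert v (nbh G v)) : ℝ) ≤ D + 1 := by
      have := card_insert_le v (nbh G v)
      have h : (#(insert v (nbh G v)) : ℝ) ≤ #(nbh G v) + 1 := by exact_mod_cast this
      linarith [hD v hv]
    obtain ⟨S, hS, hSc, hSi⟩ := ih (Y \ insert v (nbh G v))
      (fun w hw => hD w (mem_sdiff.1 hw).1) (by push_cast at hY; linarith)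
    have hvS : v ∉ S := fun h => by have := hS h; simp at this
    refine ⟨insert v S, ?_, by rw [card_insert_of_notMem hvS, hSc], hSi.insert fun y hy h => ?_⟩
    · exact insert_subset hv (hS.trans sdiff_subset)
    · have := (mem_sdiff.1 (hS hy)).2
      exact this (mem_insert_of_mem (mem_nbh.2 h))

/-- The vertices of largest value of a function. -/
theorem exists_top_subset (f : V → ℕ) (M : ℕ) (hM : M ≤ Fintype.card V) :
    ∃ X : Finset V, #X = M ∧ ∀ u ∈ X, ∀ v ∉ X, f v ≤ f u := by
  induction M with
  | zero => exact ⟨∅, by simp⟩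
  | succ M ih =>
    obtain ⟨X, hX, hf⟩ := ih (by omega)
    have hne : (univ \ X).Nonempty := by
      rw [← card_pos, card_sdiff_of_subset (subset_univ X), card_univ]; omega
    obtain ⟨w, hw, hmax⟩ := exists_max_image (univ \ X) f hne
    have hwX : w ∉ X := (mem_sdiff.1 hw).2
    refine ⟨insert w X, by rw [card_insert_of_notMem hwX, hX], fun u hu v hv => ?_⟩
    rw [mem_insert, not_or] at hv
    rcases mem_insert.1 hu with rfl | hu
    · exact hmax v (by simpa using hv.2)
    · exact hf u hu v hv.2

/-- If the vertices of `T` have few `B`-neighbours and the vertices outside `F` few `G`-neighbours,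
one finds greedily a `G`-independent set with no `B`-edge to a large part of `T`. -/
theorem exists_indep_of_few_neighbours (G B : SimpleGraph V) (K N : ℕ) (hK : 0 < K) (hN : 0 < N)
    (x β : ℝ) (hx : 0 ≤ x) (F T : Finset V) (hT : ∀ u ∈ T, (#(nbh B u) : ℝ) ≤ β)
    (hF : ∀ v ∉ F, (#(nbh G v) : ℝ) ≤ x) (j : ℕ) (hTc : N * K ^ j ≤ #T)
    (hn : #F + (j - 1) * (x + 1) + β + (Fintype.card V : ℝ) / K < Fintype.card V) :
    ∃ S T' : Finset V, #S = j ∧ Disjoint S F ∧ Indep G S ∧ T' ⊆ T ∧ N ≤ #T' ∧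
      ∀ s ∈ S, ∀ u ∈ T', ¬ B.Adj s u := by
  induction j generalizing N with
  | zero => exact ⟨∅, T, by simp, by simp, by simp [Indep], Subset.rfl, by simpa using hTc,
      by simp⟩
  | succ j ih =>
    obtain ⟨S, T', hSc, hSF, hSi, hT'T, hT'N, hST⟩ := ih (N * K) (by positivity)
      (by rw [pow_succ] at hTc; calc _ = N * (K ^ j * K) := by ring
            _ ≤ _ := hTc) (by push_cast at hn; linarith)
    set Y : Finset V := univ \ (F ∪ (S.biUnion (nbh G) ∪ S)) with hY
    have hYc : (Fintype.card V : ℝ) - (#F + j * (x + 1)) ≤ #Y := by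
      have h1 := card_sub_card_le_card_sdiff univ (F ∪ (S.biUnion (nbh G) ∪ S))
      have h2 := card_biUnion_nbh_le G S x (fun v hv => hF v (disjoint_left.1 hSF hv))
      have h3 : (#(F ∪ (S.biUnion (nbh G) ∪ S)) : ℝ) ≤ #F + #(S.biUnion (nbh G) ∪ S) := by
        exact_mod_cast card_union_le _ _
      rw [card_univ] at h1
      rw [hSc] at h2
      linarith
    have hYn : (#Y : ℝ) ≤ Fintype.card V := by exact_mod_cast card_le_univ Y
    obtain ⟨v, hvY, hv⟩ : ∃ v ∈ Y, #T' ≤ K * #{u ∈ T' | ¬ B.Adj v u} := by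
      by_contra! hcon
      have hsum : ∑ v ∈ Y, (#T' : ℝ) * (1 - 1 / K) ≤ ∑ v ∈ Y, (#{u ∈ T' | B.Adj v u} : ℝ) := by
        refine sum_le_sum fun v hv => ?_
        have h1 : ((K * #{u ∈ T' | ¬ B.Adj v u} : ℕ) : ℝ) ≤ (#T' : ℝ) := by
          exact_mod_cast (hcon v hv).le
        have h2 : (#{u ∈ T' | B.Adj v u} : ℝ) + #{u ∈ T' | ¬ B.Adj v u} = #T' := by
          exact_mod_cast card_filter_add_card_filter_not (s := T') (B.Adj v)
        have hK' : (0 : ℝ) < K := by exact_mod_cast hK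
        push_cast at h1
        have h3 : (#{u ∈ T' | ¬ B.Adj v u} : ℝ) ≤ #T' / K := by
          rw [le_div_iff₀ hK']; linarith
        have : (#T' : ℝ) * (1 - 1 / K) = #T' - #T' / K := by ring
        linarith
      have h4 : (∑ v ∈ Y, (#{u ∈ T' | B.Adj v u} : ℝ)) ≤ #T' * β := by
        have : (∑ v ∈ Y, (#{u ∈ T' | B.Adj v u} : ℝ)) = ∑ u ∈ T', (#{v ∈ Y | B.Adj u v} : ℝ) := by
          exact_mod_cast sum_card_filter_adj_comm B Y T'
        rw [this, ← nsmul_eq_mul, ← sum_const]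
        refine sum_le_sum fun u hu => (hT u (hT'T hu)).trans' ?_
        exact_mod_cast card_le_card fun w hw => mem_nbh.2 (mem_filter.1 hw).2
      rw [sum_const, nsmul_eq_mul] at hsum
      have hT'pos : (0 : ℝ) < #T' := by
        have : 0 < N * K := by positivity
        exact_mod_cast lt_of_lt_of_le this hT'N
      have h5 : (#Y : ℝ) * (1 - 1 / K) ≤ β := by
        have : (#T' : ℝ) * (#Y * (1 - 1 / K)) ≤ #T' * β := by linarith
        exact le_of_mul_le_mul_left this hT'pos
      have h6 : (#Y : ℝ) / K ≤ Fintype.card V / K := by gcongr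
      have h7 : (#Y : ℝ) * (1 - 1 / K) = #Y - #Y / K := by ring
      push_cast at hn
      linarith
    have hv' := (mem_sdiff.1 hvY).2
    simp only [mem_union, mem_biUnion, mem_nbh, not_or, not_exists, not_and] at hv'
    refine ⟨insert v S, {u ∈ T' | ¬ B.Adj v u}, ?_, ?_, ?_, (filter_subset _ _).trans hT'T, ?_, ?_⟩
    · rw [card_insert_of_notMem hv'.2.2, hSc]
    · rw [disjoint_insert_left]; exact ⟨hv'.1, hSF⟩
    · exact hSi.insert fun y hy h => hv'.2.1 y hy h.symm
    · have : N * K ≤ K * #{u ∈ T' | ¬ B.Adj v u} := hT'N.trans hv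
      rw [mul_comm] at this
      exact Nat.le_of_mul_le_mul_left this hK
    · intro s hs u hu
      rcases mem_insert.1 hs with rfl | hs
      · exact (mem_filter.1 hu).2
      · exact hST s hs u (mem_filter.1 hu).1

end Combinatorics

/-! ### Building eyes when red degrees or blue degrees are small. -/

section KeyTheorem

open scoped Classical
open Finset

variable {V : Type*} {R B : SimpleGraph V} {a b : ℕ}

lemma EyeFree.not_forall_not_blue (h : EyeFree R B a b) {A S : Finset V} (hA : #A = a) (hS : #S = b)
    (hAS : Disjoint A S) (hAi : Indep B A) (hSi : Indep R S) :
    ¬ ∀ x ∈ A, ∀ y ∈ S, ¬ B.Adj x y := by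
  obtain ⟨x, hx, y, hy, hxy⟩ := h A S hA hS hAS hAi hSi
  exact fun h' => h' x hx y hy hxy

variable [Fintype V]

/-- The vertices that are `B`-adjacent to nothing in `S`. -/
noncomputable def coNbh (B : SimpleGraph V) (S : Finset V) : Finset V :=
  univ.filter fun v => ∀ s ∈ S, ¬ B.Adj s v

lemma mem_coNbh {B : SimpleGraph V} {S : Finset V} {v : V} :
    v ∈ coNbh B S ↔ ∀ s ∈ S, ¬ B.Adj s v := by simp [coNbh]

/-- A vertex without neighbours in `S` is counted #S ≥ 2 times on the right, a vertex with exactly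
one neighbour at least once. So its count plus its number of neighbours in `S` is always at least 2.
-/
lemma sum_card_coNbh_erase_ge (B : SimpleGraph V) (S : Finset V) (hS : 2 ≤ #S) :
    2 * (Fintype.card V : ℝ) - ∑ s ∈ S, (#(nbh B s) : ℝ) ≤
      ∑ s ∈ S, (#(coNbh B (S.erase s)) : ℝ) := by
  have h1 : ∑ s ∈ S, (#(nbh B s) : ℝ) = ∑ v : V, (#{s ∈ S | B.Adj v s} : ℝ) := by
    have := sum_card_filter_adj_comm B univ S
    simp only [nbh]
    exact_mod_cast this.symm
  have h2 : ∑ s ∈ S, (#(coNbh B (S.erase s)) : ℝ) =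
      ∑ v : V, (#{s ∈ S | v ∈ coNbh B (S.erase s)} : ℝ) := by
    have : ∑ s ∈ S, #(coNbh B (S.erase s)) = ∑ v : V, #{s ∈ S | v ∈ coNbh B (S.erase s)} := by
      simp_rw [card_filter]
      rw [sum_comm]
      refine sum_congr rfl fun s _ => ?_
      rw [← card_filter, filter_mem_eq_inter, univ_inter]
    exact_mod_cast this
  have h3 : 2 * (Fintype.card V : ℝ) = ∑ v : V, (2 : ℝ) := by
    rw [sum_const, card_univ, nsmul_eq_mul]; ring
  rw [h1, h2, h3, ← sum_sub_distrib]
  refine sum_le_sum fun v _ => ?_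
  rw [sub_le_iff_le_add]
  have : 2 ≤ #{s ∈ S | v ∈ coNbh B (S.erase s)} + #{s ∈ S | B.Adj v s} := by
    rcases Nat.lt_or_ge (#{s ∈ S | B.Adj v s}) 2 with h | h
    · interval_cases hc : #{s ∈ S | B.Adj v s}
      · rw [card_eq_zero, filter_eq_empty_iff] at hc
        rw [filter_true_of_mem fun s _ => mem_coNbh.2 fun w hw h' =>
          hc (mem_of_mem_erase hw) h'.symm]
        omega
      · rw [card_eq_one] at hc
        obtain ⟨s, hs⟩ := hc
        have hsS : s ∈ S := (mem_filter.1 (hs.symm ▸ mem_singleton_self s)).1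
        have : s ∈ {s ∈ S | v ∈ coNbh B (S.erase s)} := by
          refine mem_filter.2 ⟨hsS, mem_coNbh.2 fun w hw h' => ?_⟩
          have : w ∈ ({s ∈ S | B.Adj v s} : Finset V) :=
            mem_filter.2 ⟨mem_of_mem_erase hw, h'.symm⟩
          rw [hs, mem_singleton] at this
          exact (mem_erase.1 hw).1 this
        have := card_pos.2 ⟨s, this⟩
        omega
    · omega
  exact_mod_cast this

/-- If almost all red degrees are small, there is no clique of `a + 1` vertices in red and green. -/
theorem EyeFree.not_indep_blue_of_red_small (h : EyeFree R B a b) (ha : 2 ≤ a) (hb : 1 ≤ b)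
    (ρ δ : ℝ) (hρ : 0 ≤ ρ) (X : Finset V)
    (hR : ∀ v ∉ X, (#(nbh R v) : ℝ) ≤ ρ * Fintype.card V)
    (hB : ∀ v, (#(nbh B v) : ℝ) ≤ (1 / a + δ) * Fintype.card V) (hδ : δ * (a + 1) ≤ 1 / 8)
    (hn : (a + 1) * (b * (ρ * Fintype.card V + 1) + #X + (a + 1)) <
      (3 / 8) * (Fintype.card V : ℝ)) (S : Finset V) (hS : #S = a + 1) :
    ¬ Indep B S := by
  intro hSi
  set n : ℝ := (Fintype.card V : ℝ) with hn_def
  have hn0 : 0 ≤ n := by positivity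
  have ha' : (2 : ℝ) ≤ a := by exact_mod_cast ha
  -- The blue degrees in `S` sum to at most (a+1)(1/a + δ) n ≤ (1 + 1/2 + 1/8) n, as a ≥ 2; this
  -- leaves 2n - 13n/8 = 3n/8 to share among the a + 1 choices of `s`.
  obtain ⟨s, hs, hsc⟩ : ∃ s ∈ S, (3 / 8) * n ≤ (a + 1) * #(coNbh B (S.erase s)) := by
    by_contra! hcon
    have h1 := sum_card_coNbh_erase_ge B S (by omega)
    have h2 : ∑ s ∈ S, (#(nbh B s) : ℝ) ≤ ∑ s ∈ S, (1 / a + δ) * n := sum_le_sum fun s _ => hB s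
    have h3 : ∑ s ∈ S, ((a : ℝ) + 1) * #(coNbh B (S.erase s)) < ∑ s ∈ S, (3 / 8) * n :=
      sum_lt_sum_of_nonempty (card_pos.1 (by omega)) fun s hs => hcon s hs
    rw [sum_const, nsmul_eq_mul, hS] at h2 h3
    rw [← mul_sum] at h3
    push_cast at h2 h3
    have h4 : ∑ s ∈ S, (#(coNbh B (S.erase s)) : ℝ) < (3 / 8) * n := by
      have hpos : (0 : ℝ) < a + 1 := by positivity
      exact lt_of_mul_lt_mul_left h3 hpos.le
    have h5 : ((a : ℝ) + 1) * ((1 / a + δ) * n) = n + n * (1 / a) + (δ * (a + 1)) * n := by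
      field_simp
    have h6 : (1 : ℝ) / a ≤ 1 / 2 := one_div_le_one_div_of_le (by norm_num) ha'
    nlinarith
  set Y := coNbh B (S.erase s) \ (X ∪ S) with hY
  have hYc : (#(coNbh B (S.erase s)) : ℝ) - (#X + (a + 1)) ≤ #Y := by
    have h1 := card_sub_card_le_card_sdiff (coNbh B (S.erase s)) (X ∪ S)
    have h2 : (#(X ∪ S) : ℝ) ≤ #X + #S := by exact_mod_cast card_union_le _ _
    rw [hS] at h2
    push_cast at h2
    linarith
  have hbY : ((b - 1 : ℕ) : ℝ) * (ρ * n + 1) < #Y := by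
    rw [Nat.cast_sub hb]
    have : 0 ≤ ρ * n := by positivity
    push_cast
    have h7 : b * (ρ * n + 1) + #X + (a + 1) < (#(coNbh B (S.erase s)) : ℝ) :=
      lt_of_mul_lt_mul_left (hn.trans_le hsc) (by positivity)
    linarith
  obtain ⟨T, hTY, hTc, hTi⟩ := exists_indep_subset R (ρ * n) (by positivity) (b - 1) Y
    (fun v hv => hR v fun h' => (mem_sdiff.1 hv).2 (mem_union_left _ h')) hbY
  refine h.not_forall_not_blue (A := S.erase s) (S := T) (by rw [card_erase_of_mem hs]; omega) (by omega) ?_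
    (hSi.mono (erase_subset _ _)) hTi fun x hx y hy => ?_
  · rw [disjoint_right]
    exact fun v hv hv' => (mem_sdiff.1 (hTY hv)).2 (mem_union_right _ (mem_of_mem_erase hv'))
  · exact mem_coNbh.1 (mem_sdiff.1 (hTY hy)).1 x hx

/-- A vertex joined in red and green to a clique `A` of `a` vertices that see few blue edges has
large red degree. -/
theorem EyeFree.card_le_of_notMem_blue (h : EyeFree R B a b) (hb : 2 ≤ b) (η D : ℝ) (hD : 0 ≤ D)
    (hR : ∀ v, (#(nbh R v) : ℝ) ≤ D) (A : Finset V) (hA : #A = a) (hAi : Indep B A)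
    (hAB : ∀ u ∈ A, (#(nbh B u) : ℝ) ≤ η) (v : V) (hvA : v ∉ A) (hv : ∀ u ∈ A, ¬ B.Adj u v) :
    (Fintype.card V : ℝ) ≤ a * (η + 1) + (#(nbh R v) + 1) + (b - 2) * (D + 1) := by
  by_contra! hcon
  set Z := (A.biUnion (nbh B) ∪ A) ∪ insert v (nbh R v) with hZ
  have hZc : (#Z : ℝ) ≤ a * (η + 1) + (#(nbh R v) + 1) := by
    have h1 := card_biUnion_nbh_le B A η hAB
    rw [hA] at h1
    have h2 : (#Z : ℝ) ≤ #(A.biUnion (nbh B) ∪ A) + #(insert v (nbh R v)) := by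
      exact_mod_cast card_union_le _ _
    have h3 : (#(insert v (nbh R v)) : ℝ) ≤ #(nbh R v) + 1 := by
      exact_mod_cast card_insert_le _ _
    linarith
  have hc := card_sub_card_le_card_sdiff univ Z
  rw [card_univ] at hc
  -- The remaining b - 1 vertices of the second clique, chosen so that together with `v` and `A`
  -- they would form an eye.
  obtain ⟨T, hTY, hTc, hTi⟩ := exists_indep_subset R D hD (b - 2) (univ \ Z) (fun v _ => hR v)
    (by rw [Nat.cast_sub hb]; push_cast; linarith)
  have hT : ∀ y ∈ T, (∀ u ∈ A, ¬ B.Adj u y) ∧ y ∉ A ∧ y ≠ v ∧ ¬ R.Adj v y := by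
    intro y hy
    have := (mem_sdiff.1 (hTY hy)).2
    simp only [hZ, mem_union, mem_biUnion, mem_nbh, mem_insert, not_or, not_exists, not_and] at this
    exact ⟨this.1.1, this.1.2, this.2.1, this.2.2⟩
  have hvT : v ∉ T := fun h' => (hT v h').2.2.1 rfl
  refine h.not_forall_not_blue hA (S := insert v T) (by rw [card_insert_of_notMem hvT]; omega) ?_ hAi
    (hTi.insert fun y hy => (hT y hy).2.2.2) fun x hx y hy => ?_
  · rw [disjoint_insert_right]
    exact ⟨hvA, disjoint_right.2 fun y hy => (hT y hy).2.1⟩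
  · rcases mem_insert.1 hy with rfl | hy
    · exact hv x hx
    · exact (hT y hy).1 x hx

end KeyTheorem

/-! ### The structure theorem under an upper bound on all weighted degrees. -/

section KeyTheorem

open scoped Classical
open Finset

variable {V : Type*} [Fintype V] {R B : SimpleGraph V} {a b : ℕ} {p q l ε : ℝ}

/-- A blue clique among vertices of large red degree extends to an eye. -/
theorem EyeFree.card_lt_of_red_large (h : EyeFree R B a b) (ha : 1 ≤ a) (hb : 1 ≤ b)
    (hp : 0 < p) (hq : 0 < q) (hl : 0 ≤ l) (hla : l ≤ p / a) (hε : 0 < ε)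
    (hL : ∀ v, q * #(nbh R v) + p * #(nbh B v) ≤ (l + ε) * Fintype.card V)
    (K : ℕ) (hK : 0 < K) (hKε : 1 / (K : ℝ) ≤ ε) (ρ : ℝ) (hερ : ε * (a / p + 2) < q * ρ / p)
    (Q : Finset V) (hQρ : ∀ u ∈ Q, ρ * Fintype.card V ≤ #(nbh R u)) (hQ : Indep R Q)
    (hn : 0 < Fintype.card V) (hnQ : (#Q : ℝ) + a ≤ ε * Fintype.card V) : #Q < b * K ^ a := by
  by_contra! hcon
  set n : ℝ := (Fintype.card V : ℝ) with hn_def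
  have hn0 : 0 < n := by rw [hn_def]; exact_mod_cast hn
  have ha0 : (0 : ℝ) < a := by exact_mod_cast ha
  have hdB : ∀ v, (#(nbh B v) : ℝ) ≤ (l + ε) * n / p := fun v => by
    rw [le_div_iff₀ hp]
    have := hL v
    have : 0 ≤ q * (#(nbh R v) : ℝ) := by positivity
    linarith
  have hdQ : ∀ u ∈ Q, (#(nbh B u) : ℝ) ≤ ((l + ε) * n - q * (ρ * n)) / p := fun u hu => by
    rw [le_div_iff₀ hp]
    have := hL u
    have := mul_le_mul_of_nonneg_left (hQρ u hu) hq.le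
    linarith
  obtain ⟨S, T', hSc, hSQ, hSi, hT'Q, hT'b, hST⟩ :=
    exists_indep_of_few_neighbours B B K b hK hb ((l + ε) * n / p) _ (by positivity) Q Q hdQ
      (fun v _ => hdB v) a hcon (by
        have h1 : (n : ℝ) / K ≤ ε * n := by
          have := mul_le_mul_of_nonneg_right hKε hn0.le
          rwa [one_div, inv_mul_eq_div] at this
        have h2 : (a : ℝ) * (l / p) ≤ 1 := by
          rw [le_div_iff₀ ha0] at hla
          rw [← mul_div_assoc, div_le_one hp]; linarith
        -- Blue degrees near n/a would only just block the choice of `a` vertices; the red degrees ρ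
        -- n in `Q` provide the slack q ρ n / p, which beats all error terms by `hερ`.
        have h3 : (a : ℝ) * ((l + ε) * n / p) - q * (ρ * n) / p + 2 * (ε * n) < n := by
          have e : (a : ℝ) * ((l + ε) * n / p) - q * (ρ * n) / p + 2 * (ε * n) =
            (a * (l / p)) * n + (ε * (a / p + 2) - q * ρ / p) * n := by ring
          rw [e]
          nlinarith
        have e : ((l + ε) * n - q * (ρ * n)) / p = (l + ε) * n / p - q * (ρ * n) / p := by ring
        rw [e]
        nlinarith)
  obtain ⟨T, hTT', hTc⟩ := exists_subset_card_eq hT'b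
  exact h.not_forall_not_blue hSc hTc (hSQ.mono_right (hTT'.trans hT'Q)) hSi (hQ.mono (hTT'.trans hT'Q))
    fun x hx y hy => hST x hx y (hTT' hy)

/-- A vertex joined in red and green to a clique of `a` vertices with few blue edges has itself few
blue edges, if all degrees are almost those of the extremal igraph. -/
theorem EyeFree.blue_card_le (h : EyeFree R B a b) (hb : 2 ≤ b)
    (hp : 0 < p) (hq : 0 < q) (hlb : l ≤ q / (b - 1)) (hε : 0 < ε)
    (hL : ∀ v, q * #(nbh R v) + p * #(nbh B v) ≤ (l + ε) * Fintype.card V)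
    (η : ℝ) (hεη : ε ≤ η) (hn : (a + b : ℝ) ≤ η * Fintype.card V)
    (A : Finset V) (hA : #A = a) (hAi : Indep B A)
    (hAB : ∀ u ∈ A, (#(nbh B u) : ℝ) ≤ η * Fintype.card V) (v : V) (hvA : v ∉ A)
    (hv : ∀ u ∈ A, ¬ B.Adj u v) :
    (#(nbh B v) : ℝ) ≤ (1 + q * (a + (b - 1) / q + 1)) / p * η * Fintype.card V := by
  set n : ℝ := (Fintype.card V : ℝ) with hn_def
  have hn0 : 0 ≤ n := by positivity
  have hk : (1 : ℝ) ≤ b - 1 := by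
    have : (2 : ℝ) ≤ b := by exact_mod_cast hb
    linarith
  set k : ℝ := (b : ℝ) - 1 with hk_def
  have hdR : ∀ w, (#(nbh R w) : ℝ) ≤ (1 / k + ε / q) * n := fun w => by
    have h1 := hL w
    have h2 : 0 ≤ p * (#(nbh B w) : ℝ) := by positivity
    have h3 : q * (#(nbh R w) : ℝ) ≤ (q / k + ε) * n := by nlinarith
    have e : (1 / k + ε / q) * n = (q / k + ε) * n / q := by field_simp
    rw [e, le_div_iff₀ hq]; linarith
  have h1 := h.card_le_of_notMem_blue hb (η * n) ((1 / k + ε / q) * n) (by positivity) hdR A hA hAi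
    hAB v hvA hv
  have h2 : ((b : ℝ) - 2) * ((1 / k + ε / q) * n + 1) ≤
      n - n / k + (k / q) * η * n + (k - 1) := by
    have e1 : (b : ℝ) - 2 = k - 1 := by rw [hk_def]; ring
    have e2 : (k - 1) * ((1 / k + ε / q) * n + 1) =
      n - n / k + (k - 1) / q * ε * n + (k - 1) := by field_simp
    rw [e1, e2]
    have : (k - 1) / q * ε ≤ k / q * η := by gcongr; linarith
    have := mul_le_mul_of_nonneg_right this hn0
    linarith
  -- This red degree costs almost (q/k) n ≥ l n, nearly all of the permitted loss at `v`, so only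
  -- O(η n) is left for blue.
  have h3 : n / k - (a + k / q + 1) * η * n ≤ #(nbh R v) := by
    have : (a : ℝ) + k ≤ η * n := by linarith
    linarith
  have h4 := mul_le_mul_of_nonneg_left h3 hq.le
  have h5 := hL v
  have h6 : (l + ε) * n ≤ (q / k + η) * n := by gcongr
  have e : (1 + q * (a + k / q + 1)) / p * η * n = (1 + q * (a + k / q + 1)) * η * n / p := by ring
  have e' : q * (n / k) = q / k * n := by ring
  rw [e, le_div_iff₀ hp]
  nlinarith

/-- If a clique of `a` vertices in red and green has few blue edges, there is no clique of `b`
vertices in blue and green. -/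
theorem EyeFree.not_indep_red_of_few_blue (h : EyeFree R B a b) (ha : 2 ≤ a) (hb : 2 ≤ b)
    (hp : 0 < p) (hq : 0 < q) (hp1 : p ≤ 1) (hla : l ≤ p / a) (hlb : l ≤ q / (b - 1))
    (hε : 0 < ε)
    (hL : ∀ v, q * #(nbh R v) + p * #(nbh B v) ≤ (l + ε) * Fintype.card V)
    (c₂ : ℝ) (hc₂ : c₂ = (1 + q * (a + (b - 1) / q + 1)) / p)
    (γ : ℝ) (hεγ : ε / p ≤ γ) (hγc : 16 * ((a + b + 1) * (c₂ ^ 2 * γ)) ≤ 1)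
    (hn : (a : ℝ) + b + 1 ≤ γ * Fintype.card V)
    (A : Finset V) (hAc : #A = a) (hA : Indep B A)
    (hAγ : ∀ u ∈ A, (#(nbh B u) : ℝ) ≤ γ * Fintype.card V)
    (S : Finset V) (hS : #S = b) : ¬ Indep R S := by
  intro hSi
  set n : ℝ := (Fintype.card V : ℝ) with hn_def
  have ha2 : (2 : ℝ) ≤ a := by exact_mod_cast ha
  have hb2 : (2 : ℝ) ≤ b := by exact_mod_cast hb
  have hγ0 : 0 < γ := lt_of_lt_of_le (by positivity) hεγ
  have hεγ' : ε ≤ γ := le_trans (by rw [le_div_iff₀ hp]; nlinarith) hεγ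
  have hn0 : 0 < n := by
    have : 0 < γ * n := lt_of_lt_of_le (by positivity) hn
    exact pos_of_mul_pos_right this hγ0.le
  have hla2 : l ≤ p / 2 := hla.trans (by gcongr)
  have hk1 : (1 : ℝ) ≤ b - 1 := by linarith
  have hc₂1 : 1 ≤ c₂ := by
    rw [hc₂, le_div_iff₀ hp]
    have : 0 ≤ q * (a + ((b : ℝ) - 1) / q + 1) := by positivity
    linarith
  -- The bound γ is propagated twice, each time at the cost of a factor `c₂`: first to vertices with
  -- no blue edge to `A`, then to all vertices.
  set η : ℝ := c₂ ^ 2 * γ with hη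
  have hγη₂ : γ ≤ c₂ * γ := le_mul_of_one_le_left hγ0.le hc₂1
  have hη₂η : c₂ * γ ≤ η := by
    have : c₂ * γ ≤ c₂ * (c₂ * γ) := le_mul_of_one_le_left (by positivity) hc₂1
    rw [hη]; linarith
  have hη0 : 0 < η := by positivity
  have hγn : γ * n ≤ η * n := by gcongr; linarith
  have hη₂n : c₂ * γ * n ≤ η * n := by gcongr
  have hηpos : 0 ≤ η * n := by positivity
  have hηsmall : (a + b + 1) * (η * n) ≤ n / 16 := by nlinarith
  have hηn : η * n ≤ n / 16 / 5 := by
    have : 5 * (η * n) ≤ (a + b + 1) * (η * n) := by gcongr; linarith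
    linarith
  have haη : (a : ℝ) * (η * n) ≤ n / 16 := by
    have : (a : ℝ) * (η * n) ≤ (a + b + 1) * (η * n) := by gcongr; linarith
    linarith
  have hbη : (b : ℝ) * (η * n) ≤ n / 16 := by
    have : (b : ℝ) * (η * n) ≤ (a + b + 1) * (η * n) := by gcongr; linarith
    linarith
  have hprop := fun (η' : ℝ) (h1 : ε ≤ η') (h2 : (a + b : ℝ) ≤ η' * Fintype.card V) =>
    h.blue_card_le hb hp hq hlb hε hL η' h1 h2
  rw [← hc₂] at hprop
  have hstep1 : ∀ v ∉ A, (∀ u ∈ A, ¬ B.Adj u v) → (#(nbh B v) : ℝ) ≤ c₂ * γ * n :=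
    fun v hvA hv => hprop γ hεγ' (by linarith) A hAc hA hAγ v hvA hv
  have hall : ∀ v, (#(nbh B v) : ℝ) ≤ η * n := by
    intro v
    set Y := univ \ ((A.biUnion (nbh B) ∪ A) ∪ insert v (nbh B v)) with hY
    have hYp : ∀ y ∈ Y, (∀ u ∈ A, ¬ B.Adj u y) ∧ y ∉ A ∧ y ≠ v ∧ ¬ B.Adj v y := by
      intro y hy
      have := (mem_sdiff.1 hy).2
      simp only [mem_union, mem_biUnion, mem_nbh, mem_insert, not_or, not_exists,
        not_and] at this
      exact ⟨this.1.1, this.1.2, this.2.1, this.2.2⟩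
    -- Since a ≥ 2, blue covers at most about half of the vertices at `v`; enough vertices avoid
    -- blue edges to both `A` and `v` to hold a new clique `A'` that certifies `v`.
    have hvB : (#(nbh B v) : ℝ) ≤ n / 2 + γ * n := by
      have h1 := hL v
      have h2 : 0 ≤ q * (#(nbh R v) : ℝ) := by positivity
      have h3 : (l + ε) * n ≤ (p / 2 + ε) * n := by gcongr
      have h4 : (#(nbh B v) : ℝ) ≤ (p / 2 + ε) * n / p := by rw [le_div_iff₀ hp]; linarith
      have e : (p / 2 + ε) * n / p = n / 2 + ε / p * n := by field_simp
      have h5 : ε / p * n ≤ γ * n := by gcongr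
      linarith
    have hYc : n - (a * (γ * n + 1) + (n / 2 + γ * n + 1)) ≤ #Y := by
      have h1 := card_sub_card_le_card_sdiff univ ((A.biUnion (nbh B) ∪ A) ∪ insert v (nbh B v))
      have h2 := card_biUnion_nbh_le B A (γ * n) hAγ
      have h3 : (#((A.biUnion (nbh B) ∪ A) ∪ insert v (nbh B v)) : ℝ) ≤
          #(A.biUnion (nbh B) ∪ A) + #(insert v (nbh B v)) := by
        exact_mod_cast card_union_le _ _
      have h4 : (#(insert v (nbh B v)) : ℝ) ≤ #(nbh B v) + 1 := by
        exact_mod_cast card_insert_le _ _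
      rw [hAc] at h2
      rw [card_univ] at h1
      linarith
    obtain ⟨A', hA'Y, hA'c, hA'i⟩ := exists_indep_subset B (η * n) (by positivity) (a - 1) Y
      (fun y hy => (hstep1 y (hYp y hy).2.1 (hYp y hy).1).trans hη₂n) (by
        rw [Nat.cast_sub (by omega)]
        push_cast
        have h1 : (a : ℝ) * (γ * n) ≤ a * (η * n) := by gcongr
        linarith)
    refine (hprop (c₂ * γ) (by linarith) (by nlinarith) A' (by omega) hA'i (fun u hu => ?_) v ?_
      fun u hu h' => (hYp u (hA'Y hu)).2.2.2 h'.symm).trans (le_of_eq (by rw [hη]; ring))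
    · exact hstep1 u (hYp u (hA'Y hu)).2.1 (hYp u (hA'Y hu)).1
    · exact fun h' => (hYp v (hA'Y h')).2.2.1 rfl
  -- With blue scarce everywhere, most vertices have no blue edge to `S`, and `a` of them without
  -- blue pairs complete `S` to an eye.
  set Y := univ \ (S.biUnion (nbh B) ∪ S) with hY
  have hYc : n - b * (η * n + 1) ≤ #Y := by
    have h1 := card_sub_card_le_card_sdiff univ (S.biUnion (nbh B) ∪ S)
    have h2 := card_biUnion_nbh_le B S (η * n) (fun u _ => hall u)
    rw [hS] at h2
    rw [card_univ] at h1
    linarith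
  obtain ⟨A', hA'Y, hA'c, hA'i⟩ := exists_indep_subset B (η * n) (by positivity) (a - 1) Y
    (fun y _ => hall y) (by
      rw [Nat.cast_sub (by omega)]
      push_cast
      linarith)
  have hYp : ∀ y ∈ Y, (∀ u ∈ S, ¬ B.Adj u y) ∧ y ∉ S := by
    intro y hy
    have := (mem_sdiff.1 hy).2
    simpa only [mem_union, mem_biUnion, mem_nbh, not_or, not_exists, not_and] using this
  exact h.not_forall_not_blue (A := A') (by omega) hS
    (disjoint_left.2 fun y hy => (hYp y (hA'Y hy)).2) hA'i hSi
    fun x hx y hy h' => (hYp x (hA'Y hx)).1 y hy h'.symm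

/-- If a large clique in red and green lies among the vertices of largest red degree, there is no
clique of `b` vertices in blue and green. -/
theorem EyeFree.not_indep_red_of_clique (h : EyeFree R B a b) (ha : 2 ≤ a) (hb : 2 ≤ b)
    (hp : 0 < p) (hq : 0 < q) (hp1 : p ≤ 1) (hla : l ≤ p / a) (hlb : l ≤ q / (b - 1))
    (hε : 0 < ε)
    (hL : ∀ v, q * #(nbh R v) + p * #(nbh B v) ≤ (l + ε) * Fintype.card V)
    (K : ℕ) (hK : 0 < K) (hKε : 1 / (K : ℝ) ≤ ε) (hεp : 8 * ε ≤ p)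
    (c₁ c₂ : ℝ) (hc₁ : c₁ = (1 + 3 * q / (p * (b - 1) - q)) / p)
    (hc₂ : c₂ = (1 + q * (a + (b - 1) / q + 1)) / p)
    (hεc : 16 * ((a + b + 1) * (c₂ ^ 2 * c₁ * ε)) ≤ 1)
    (X T : Finset V) (hTX : T ⊆ X) (hX : ∀ u ∈ X, ∀ v ∉ X, #(nbh R v) ≤ #(nbh R u))
    (hT : Indep B T) (hTc : a * K ^ b ≤ #T)
    (hn : 0 < Fintype.card V) (hnX : (#X : ℝ) + a + b + 1 ≤ ε * Fintype.card V)
    (S : Finset V) (hS : #S = b) : ¬ Indep R S := by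
  intro hSi
  set n : ℝ := (Fintype.card V : ℝ) with hn_def
  have hn0 : 0 < n := by rw [hn_def]; exact_mod_cast hn
  have ha2 : (2 : ℝ) ≤ a := by exact_mod_cast ha
  have hb2 : (2 : ℝ) ≤ b := by exact_mod_cast hb
  have hTne : T.Nonempty := card_pos.1 (lt_of_lt_of_le (by positivity) hTc)
  obtain ⟨u₀, hu₀, hmin⟩ := exists_min_image T (fun u => #(nbh R u)) hTne
  set x : ℝ := (#(nbh R u₀) : ℝ) with hx
  have hx0 : 0 ≤ x := by positivity
  have hla2 : l ≤ p / 2 := hla.trans (by gcongr)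
  have hdT : ∀ u ∈ T, (#(nbh B u) : ℝ) ≤ ((l + ε) * n - q * x) / p := fun u hu => by
    rw [le_div_iff₀ hp]
    have h1 := hL u
    have h2 : x ≤ #(nbh R u) := Nat.cast_le.2 (hmin u hu)
    have := mul_le_mul_of_nonneg_left h2 hq.le
    linarith
  -- Outside `X` red degrees are at most `x`, and in `T` the loss bound leaves little room for blue.
  -- If this inequality failed, `b` vertices without red pairs could be chosen with no blue edge to
  -- `a` vertices of `T`.
  have hfail : n ≤ #X + (b - 1) * (x + 1) + ((l + ε) * n - q * x) / p + n / K := by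
    by_contra! hcon
    obtain ⟨S', T', hSc, hSX, hSi', hT'T, hT'a, hST⟩ :=
      exists_indep_of_few_neighbours R B K a hK (by omega) x _ hx0 X T hdT
        (fun v hv => Nat.cast_le.2 (hX u₀ (hTX hu₀) v hv)) b hTc hcon
    obtain ⟨A, hAT', hAc⟩ := exists_subset_card_eq hT'a
    exact h.not_forall_not_blue hAc hSc (hSX.symm.mono_left (hAT'.trans (hT'T.trans hTX)))
      (hT.mono (hAT'.trans hT'T)) hSi' fun u hu y hy h' => hST y hy u (hAT' hu) h'.symm
  have hnK : n / K ≤ ε * n := by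
    have := mul_le_mul_of_nonneg_right hKε hn0.le
    rwa [one_div, inv_mul_eq_div] at this
  set k : ℝ := (b : ℝ) - 1 with hk_def
  have hk1 : 1 ≤ k := by rw [hk_def]; linarith
  have hmain : p * n ≤ (p * k - q) * x + (l + 3 * ε) * n := by
    have h1 : n ≤ (#X + k) + k * x + ((l + ε) * n - q * x) / p + ε * n := by linarith
    have h2 := mul_le_mul_of_nonneg_left h1 hp.le
    have e : p * ((#X + k) + k * x + ((l + ε) * n - q * x) / p + ε * n) =
      p * (#X + k) + p * k * x + ((l + ε) * n - q * x) + p * (ε * n) := by field_simp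
    rw [e] at h2
    have h3 : p * (#X + k) ≤ 1 * (ε * n) := by
      apply mul_le_mul hp1 _ (by positivity) zero_le_one
      linarith
    have h4 : p * (ε * n) ≤ 1 * (ε * n) := by gcongr
    linarith
  -- If p k ≤ q, a larger `x` does not help, and `hmain` contradicts l ≤ p/2 and 8ε ≤ p. Otherwise
  -- `hmain` bounds `x` from below; only here does `c₁` have a positive denominator.
  rcases le_or_gt (p * k) q with hkq | hkq
  · have h1 : (p * k - q) * x ≤ 0 := mul_nonpos_of_nonpos_of_nonneg (by linarith) hx0
    nlinarith
  have hD : 0 < p * k - q := by linarith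
  have hc₁p : 1 / p ≤ c₁ := by
    rw [hc₁]
    gcongr
    have : 0 ≤ 3 * q / (p * k - q) := by positivity
    linarith
  have hc₁1 : 1 ≤ c₁ := (one_le_one_div hp hp1).trans hc₁p
  have hxlow : n / k - 3 * ε * n / (p * k - q) ≤ x := by
    have h1 : (l + 3 * ε) * n ≤ (q / k + 3 * ε) * n := by gcongr
    have e : n / k - 3 * ε * n / (p * k - q) = (p * n - (q / k + 3 * ε) * n) / (p * k - q) := by
      rw [eq_div_iff hD.ne', sub_mul, div_mul_cancel₀ _ hD.ne']
      field_simp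
      ring
    rw [e, div_le_iff₀ hD]
    linarith
  have hTη : ∀ u ∈ T, (#(nbh B u) : ℝ) ≤ c₁ * ε * n := fun u hu => by
    refine (hdT u hu).trans ?_
    have h1 := mul_le_mul_of_nonneg_left hxlow hq.le
    have h2 : (l + ε) * n ≤ (q / k + ε) * n := by gcongr
    have e : c₁ * ε * n = (ε * n + q * (3 * ε * n / (p * k - q))) / p := by rw [hc₁]; ring
    rw [e]
    gcongr
    have e' : q * (n / k) = q / k * n := by ring
    rw [mul_sub] at h1
    linarith
  obtain ⟨A, hAT, hAc⟩ : ∃ A ⊆ T, #A = a := exists_subset_card_eq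
    (le_trans (Nat.le_mul_of_pos_right a (by positivity)) hTc)
  have h16 : 16 * ((a + b + 1) * (c₂ ^ 2 * (c₁ * ε))) ≤ 1 := by rw [← mul_assoc (c₂ ^ 2)]; exact hεc
  refine h.not_indep_red_of_few_blue ha hb hp hq hp1 hla hlb hε hL c₂ hc₂ (c₁ * ε) ?_ h16 ?_
    A hAc (hT.mono hAT) (fun u hu => hTη u (hAT hu)) S hS hSi
  · rw [← one_div_mul_eq_div]
    gcongr
  · have h1 : ε * n ≤ c₁ * ε * n := by
      have := le_mul_of_one_le_left hε.le hc₁1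
      gcongr
    have : (0 : ℝ) ≤ #X := by positivity
    linarith

/-- Serves to meet several smallness conditions on ε at once. No sign is required of `C`, which
matters because `c₁` may be negative or contain a division by zero in a case where it plays no role.
-/
lemma eventually_mul_le (C : ℝ) {d : ℝ} (hd : 0 < d) :
    ∀ᶠ ε in nhdsWithin (0 : ℝ) (Set.Ioi 0), ε * C < d := by
  have h1 : Filter.Tendsto (fun ε : ℝ => ε * C) (nhdsWithin 0 (Set.Ioi 0)) (nhds (0 * C)) :=
    ((continuous_id.mul continuous_const).tendsto (0 : ℝ)).mono_left nhdsWithin_le_nhds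
  rw [zero_mul] at h1
  exact h1.eventually_lt_const hd

/-- If all weighted degrees of an eye-free igraph are almost as large as those in the extremal
igraphs, there is no red and green `K_{a+1}` or no blue and green `K_b`. -/
theorem exists_forall_eyeFree_not_indep (ha : 2 ≤ a) (hb : 2 ≤ b)
    (hp : 0 < p) (hq : 0 < q) (hp1 : p ≤ 1) (hl : 0 ≤ l) (hla : l ≤ p / a)
    (hlb : l ≤ q / (b - 1)) :
    ∃ ε > 0, ∃ n₀ : ℕ, ∀ (V : Type) [Fintype V] (R B : SimpleGraph V), n₀ ≤ Fintype.card V →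
      Disjoint R B → EyeFree R B a b →
      (∀ v, q * #(nbh R v) + p * #(nbh B v) ≤ (l + ε) * Fintype.card V) →
      (∀ S : Finset V, #S = a + 1 → ¬ Indep B S) ∨ (∀ S : Finset V, #S = b → ¬ Indep R S) := by
  have ha0 : (0 : ℝ) < a := by positivity
  have hb0 : (0 : ℝ) < b := by positivity
  set c₁ : ℝ := (1 + 3 * q / (p * (b - 1) - q)) / p with hc₁
  set c₂ : ℝ := (1 + q * (a + (b - 1) / q + 1)) / p with hc₂
  set ρ : ℝ := 1 / (16 * (a + 1) * b) with hρ
  have hρ0 : 0 < ρ := by positivity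
  obtain ⟨ε, ⟨⟨⟨⟨h1, h2⟩, h3⟩, h4⟩, h5⟩, hε⟩ :=
    (((((eventually_mul_le (a / p + 2) (by positivity : 0 < q * ρ / p)).and
      (eventually_mul_le 8 hp)).and
      (eventually_mul_le (16 * ((a + b + 1) * (c₂ ^ 2 * c₁))) one_pos)).and
      (eventually_mul_le ((a + 1) / p) (by norm_num : (0 : ℝ) < 1 / 8))).and
      (eventually_mul_le 16 one_pos)).and self_mem_nhdsWithin |>.exists
  replace hε : 0 < ε := hε
  obtain ⟨K, hKε⟩ := exists_nat_gt (1 / ε)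
  have hK0 : (0 : ℝ) < K := lt_trans (by positivity) hKε
  have hK : 0 < K := by exact_mod_cast hK0
  have hKε' : 1 / (K : ℝ) ≤ ε := by
    rw [div_le_iff₀ hK0]; rw [div_lt_iff₀ hε] at hKε; linarith
  -- Large enough for Ramsey's theorem; the factors K^a and K^b pay for the shrinking by K in each
  -- greedy step.
  set M : ℕ := 2 ^ (b * K ^ a + a * K ^ b) with hM
  obtain ⟨n₀, hn₀⟩ := exists_nat_gt (((a + 1) * (b + M + a + 1) : ℝ) / ε)
  refine ⟨ε, hε, n₀, fun V _ R B hV hRB h hL => ?_⟩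
  set n : ℝ := (Fintype.card V : ℝ) with hn_def
  have hnbig : ((a + 1) * (b + M + a + 1) : ℝ) ≤ ε * n := by
    rw [div_lt_iff₀ hε] at hn₀
    have : (n₀ : ℝ) ≤ n := Nat.cast_le.2 hV
    nlinarith
  have hMn : (M : ℝ) + a + b + 1 ≤ ε * n := by
    have : 0 ≤ (a : ℝ) * (b + M + a + 1) := by positivity
    linarith
  have hn0 : 0 < n := by
    have : 0 < ε * n := lt_of_lt_of_le (by positivity) hnbig
    exact pos_of_mul_pos_right this hε.le
  have hnc : 0 < Fintype.card V := Nat.cast_pos.1 hn0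
  obtain ⟨X, hXc, hX⟩ := exists_top_subset (fun v => #(nbh R v)) M (by
    have : (M : ℝ) ≤ n := by nlinarith
    exact Nat.cast_le.1 this)
  by_cases hsmall : ∃ u ∈ X, (#(nbh R u) : ℝ) < ρ * n
  · left
    obtain ⟨u, hu, hur⟩ := hsmall
    have hdB : ∀ v, (#(nbh B v) : ℝ) ≤ (1 / a + ε / p) * n := fun v => by
      have h6 := hL v
      have h7 : 0 ≤ q * (#(nbh R v) : ℝ) := by positivity
      have h8 : (l + ε) * n ≤ (p / a + ε) * n := by gcongr
      have e : (1 / a + ε / p) * n = (p / a + ε) * n / p := by field_simp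
      rw [e, le_div_iff₀ hp]; linarith
    refine fun S hS => h.not_indep_blue_of_red_small ha (by omega) ρ (ε / p) hρ0.le X
      (fun v hv => ?_) hdB ?_ ?_ S hS
    · have : (#(nbh R v) : ℝ) ≤ #(nbh R u) := by exact_mod_cast hX u hu v hv
      linarith
    · have e : ε / p * (a + 1) = ε * ((a + 1) / p) := by ring
      linarith
    · have e : ((a : ℝ) + 1) * (b * (ρ * n + 1) + #X + (a + 1)) =
          n / 16 + (a + 1) * (b + M + a + 1) := by
        rw [hXc, hρ]; field_simp; ring
      rw [← hn_def, e]
      nlinarith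
  · push Not at hsmall
    rcases exists_clique_or_indep B (b * K ^ a) (a * K ^ b) X hXc.ge with
      ⟨Q, hQX, hQc, hQ⟩ | ⟨T, hTX, hTc, hT⟩
    · have hQi : Indep R Q := fun x hx y hy hxy =>
        SimpleGraph.disjoint_left.1 hRB x y hxy (hQ x hx y hy hxy.ne)
      have hQn : (#Q : ℝ) ≤ M := by
        rw [← hXc]; exact_mod_cast card_le_card hQX
      have := h.card_lt_of_red_large (by omega) (by omega) hp hq hl hla hε hL K hK hKε' ρ h1 Q
        (fun u hu => hsmall u (hQX hu)) hQi hnc (by linarith)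
      omega
    · right
      exact fun S hS => h.not_indep_red_of_clique ha hb hp hq hp1 hla hlb hε hL K hK hKε'
        (by linarith) c₁ c₂ hc₁ hc₂ (by linarith) X T hTX hX hT hTc.ge hnc
        (by rw [hXc]; exact hMn) S hS

end KeyTheorem

/-! ### From igraphs to the graphs of purely red and purely blue pairs. -/

section Translation

open scoped Classical
open Finset

variable {V W : Type*}

namespace Igraph

lemma labelGraph_pullback_adj (C : Igraph V) (f : W ↪ V) (c : Colour) (x y : W) :
    (EdgeLabeling.labelGraph (TopEdgeLabeling.pullback C f) c).Adj x y ↔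
      (C.labelGraph c).Adj (f x) (f y) := by
  rw [TopEdgeLabeling.labelGraph_adj, TopEdgeLabeling.labelGraph_adj]
  constructor
  · rintro ⟨H, h⟩
    exact ⟨f.injective.ne H, h⟩
  · rintro ⟨H, h⟩
    exact ⟨fun h' => H (congrArg f h'), h⟩

lemma redGraph_eq_compl (C : Igraph V) : C.redGraph = (C.labelGraph Colour.blue)ᶜ := by
  ext x y
  simp only [redGraph, sup_adj, TopEdgeLabeling.labelGraph_adj, compl_adj]
  by_cases h : x = y
  · simp [h]
  · cases hc : EdgeLabeling.get C x y h <;> simp [h, hc]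

lemma blueGraph_eq_compl (C : Igraph V) : C.blueGraph = (C.labelGraph Colour.red)ᶜ := by
  ext x y
  simp only [blueGraph, sup_adj, TopEdgeLabeling.labelGraph_adj, compl_adj]
  by_cases h : x = y
  · simp [h]
  · cases hc : EdgeLabeling.get C x y h <;> simp [h, hc]

lemma redGraph_pullback_adj (C : Igraph V) (f : W ↪ V) (x y : W) :
    (redGraph (TopEdgeLabeling.pullback C f)).Adj x y ↔ C.redGraph.Adj (f x) (f y) := by
  simp only [redGraph, sup_adj, labelGraph_pullback_adj]

lemma blueGraph_pullback_adj (C : Igraph V) (f : W ↪ V) (x y : W) :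
    (blueGraph (TopEdgeLabeling.pullback C f)).Adj x y ↔ C.blueGraph.Adj (f x) (f y) := by
  simp only [blueGraph, sup_adj, labelGraph_pullback_adj]

lemma IsFree.pullback {U : Type*} {H : SimpleGraph U} {C : Igraph V} (h : C.IsFree H) (f : W ↪ V) :
    IsFree (TopEdgeLabeling.pullback C f) H := by
  rintro ⟨g, hr, hb⟩
  rw [map_le_iff_le_comap] at hr hb
  refine h ⟨g.trans f, ?_, ?_⟩
  · rw [map_le_iff_le_comap]
    exact fun x y hxy => (redGraph_pullback_adj C f _ _).1 (hr hxy)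
  · rw [map_le_iff_le_comap]
    exact fun x y hxy => (blueGraph_pullback_adj C f _ _).1 (hb hxy)

end Igraph

lemma eyeGraph_adj {a b : ℕ} (x y : Fin a ⊕ Fin b) :
    (eyeGraph a b).Adj x y ↔ x ≠ y ∧ ¬ (x.isRight ∧ y.isRight) := by
  simp only [eyeGraph, sdiff_adj, top_adj, SimpleGraph.map_adj]
  rcases x with x | x <;> rcases y with y | y <;> simp

lemma Igraph.IsFree.eyeFree {a b : ℕ} {C : Igraph V} (h : C.IsFree (eyeGraph a b)) :
    EyeFree (C.labelGraph Colour.red) (C.labelGraph Colour.blue) a b := by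
  intro A S hA hS hAS hAi hSi
  by_contra! hno
  let eA := A.equivFinOfCardEq hA
  let eS := S.equivFinOfCardEq hS
  let f : Fin a ⊕ Fin b ↪ V :=
    { toFun := Sum.elim (fun i => (eA.symm i : V)) (fun i => (eS.symm i : V))
      inj' := by
        refine Function.Injective.sumElim (Subtype.val_injective.comp eA.symm.injective)
          (Subtype.val_injective.comp eS.symm.injective) fun i j hij => ?_
        exact disjoint_left.1 hAS (eA.symm i).2 (hij ▸ (eS.symm j).2) }
  refine h ⟨f, ?_, ?_⟩
  · rw [map_le_iff_le_comap, redGraph_eq_compl]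
    intro x y hxy
    rw [eyeGraph_adj] at hxy
    rw [comap_adj, compl_adj]
    refine ⟨f.injective.ne hxy.1, ?_⟩
    rcases x with x | x <;> rcases y with y | y
    · exact hAi _ (eA.symm x).2 _ (eA.symm y).2
    · exact hno _ (eA.symm x).2 _ (eS.symm y).2
    · exact fun h' => hno _ (eA.symm y).2 _ (eS.symm x).2 h'.symm
    · simp at hxy
  · rw [map_le_iff_le_comap, blueGraph_eq_compl]
    intro x y hxy
    rw [compl_adj, eyeGraph_adj] at hxy
    rw [comap_adj, compl_adj]
    refine ⟨f.injective.ne hxy.1, ?_⟩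
    rcases x with x | x <;> rcases y with y | y
    · simp at hxy
    · simp at hxy
    · simp at hxy
    · exact hSi _ (eS.symm x).2 _ (eS.symm y).2

lemma cliqueFree_compl_of_forall_not_indep {G : SimpleGraph V} {m : ℕ}
    (h : ∀ S : Finset V, #S = m → ¬ Indep G S) : Gᶜ.CliqueFree m := by
  intro S hS
  refine h S hS.card_eq fun x hx y hy hxy => ?_
  exact (hS.isClique hx hy hxy.ne).2 hxy

namespace Igraph

/-- The `a` dominating vertices of the eye and any one of the other `b` form a K_{a+1}. -/
lemma isFree_of_redGraph_cliqueFree {a b : ℕ} (hb : 1 ≤ b) {C : Igraph V}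
    (h : C.redGraph.CliqueFree (a + 1)) : C.IsFree (eyeGraph a b) := by
  rintro ⟨f, hr, -⟩
  rw [map_le_iff_le_comap] at hr
  let g : Fin a ⊕ Unit ↪ Fin a ⊕ Fin b :=
    (Function.Embedding.refl _).sumMap ⟨fun _ => ⟨0, hb⟩, fun _ _ _ => rfl⟩
  refine h (univ.map (g.trans f)) ⟨fun x hx y hy hxy => ?_, by simp⟩
  simp only [coe_map, coe_univ, Set.image_univ, Set.mem_range] at hx hy
  obtain ⟨x, rfl⟩ := hx
  obtain ⟨y, rfl⟩ := hy
  refine hr ((eyeGraph_adj _ _).2 ⟨fun h' => hxy (congrArg f h'), ?_⟩)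
  rcases x with x | x <;> rcases y with y | y <;> simp_all [g]

lemma isFree_of_blueGraph_cliqueFree {a b : ℕ} {C : Igraph V}
    (h : C.blueGraph.CliqueFree b) : C.IsFree (eyeGraph a b) := by
  rintro ⟨f, -, hb⟩
  rw [map_le_iff_le_comap] at hb
  refine h (univ.map (Function.Embedding.inr.trans f)) ⟨fun x hx y hy hxy => ?_, by simp⟩
  simp only [coe_map, coe_univ, Set.image_univ, Set.mem_range] at hx hy
  obtain ⟨x, rfl⟩ := hx
  obtain ⟨y, rfl⟩ := hy
  refine hb ?_
  rw [compl_adj, eyeGraph_adj]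
  exact ⟨fun h' => hxy (congrArg f h'), by simp⟩

end Igraph

/-! ### Weight as the number of pairs minus losses. -/

section Weight

/-- The weight lost on a pair of vertices because it is not green. -/
noncomputable def pairLoss (p : ℝ) (C : Igraph V) (v w : V) : ℝ :=
  p * (if (C.labelGraph Colour.blue).Adj v w then 1 else 0) +
    (1 - p) * (if (C.labelGraph Colour.red).Adj v w then 1 else 0)

/-- The weight of the part of an igraph inside a set of vertices. -/
noncomputable def weightOn (p : ℝ) (C : Igraph V) (s : Finset V) : ℝ :=
  (#s * (#s - 1) - ∑ v ∈ s, ∑ w ∈ s, pairLoss p C v w) / 2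

lemma pairLoss_pullback (p : ℝ) (C : Igraph V) (f : W ↪ V) (v w : W) :
    pairLoss p (TopEdgeLabeling.pullback C f) v w = pairLoss p C (f v) (f w) := by
  simp only [pairLoss, Igraph.labelGraph_pullback_adj]

lemma pairLoss_comm (p : ℝ) (C : Igraph V) (v w : V) : pairLoss p C v w = pairLoss p C w v := by
  simp only [pairLoss, SimpleGraph.adj_comm]

lemma pairLoss_self (p : ℝ) (C : Igraph V) (v : V) : pairLoss p C v v = 0 := by
  simp [pairLoss]

lemma pairLoss_nonneg {p : ℝ} (hp : 0 ≤ p) (hp1 : p ≤ 1) (C : Igraph V) (v w : V) :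
    0 ≤ pairLoss p C v w := by
  have : 0 ≤ 1 - p := by linarith
  unfold pairLoss
  positivity

lemma weightOn_sub_weightOn_erase [DecidableEq V] (p : ℝ) (C : Igraph V) (s : Finset V) {v : V} (hv : v ∈ s) :
    weightOn p C s - weightOn p C (s.erase v) = #s - 1 - ∑ w ∈ s, pairLoss p C v w := by
  have hcard : (#(s.erase v) : ℝ) = #s - 1 := by
    rw [card_erase_of_mem hv, Nat.cast_sub (card_pos.2 ⟨v, hv⟩), Nat.cast_one]
  have h1 : ∑ u ∈ s, ∑ w ∈ s, pairLoss p C u w =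
      ∑ u ∈ s.erase v, ∑ w ∈ s.erase v, pairLoss p C u w + 2 * ∑ w ∈ s, pairLoss p C v w := by
    have h2 : ∀ u, ∑ w ∈ s, pairLoss p C u w =
        ∑ w ∈ s.erase v, pairLoss p C u w + pairLoss p C u v := fun u =>
      (sum_erase_add s _ hv).symm
    rw [← sum_erase_add s _ hv]
    simp_rw [h2]
    rw [sum_add_distrib, pairLoss_self]
    simp_rw [fun u => pairLoss_comm p C u v]
    ring
  simp only [weightOn, hcard, h1]
  ring

variable [Fintype V]

lemma two_mul_ncard_edgeSet (G : SimpleGraph V) :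
    2 * (G.edgeSet.ncard : ℝ) = ∑ v, (#(nbh G v) : ℝ) := by
  have h := G.sum_degrees_eq_twice_card_edges
  rw [Set.ncard_eq_toFinset_card', ← edgeFinset]
  have h2 : ∀ v, #(nbh G v) = G.degree v := fun v => by
    rw [← card_neighborFinset_eq_degree]
    congr 1
    ext w
    simp [mem_nbh]
  simp_rw [h2]
  exact_mod_cast h.symm

lemma card_nbh_compl (G : SimpleGraph V) (v : V) :
    (#(nbh Gᶜ v) : ℝ) = Fintype.card V - 1 - #(nbh G v) := by
  have h1 : nbh Gᶜ v = univ \ insert v (nbh G v) := by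
    ext w
    simp only [mem_nbh, compl_adj, mem_sdiff, mem_univ, mem_insert, true_and, not_or, ne_eq,
      eq_comm]
  have hv : v ∉ nbh G v := by simp [mem_nbh]
  have h2 : #(nbh Gᶜ v) + #(insert v (nbh G v)) = Fintype.card V := by
    rw [h1, card_sdiff_add_card_eq_card (subset_univ _), card_univ]
  rw [card_insert_of_notMem hv] at h2
  have h3 : (#(nbh Gᶜ v) : ℝ) + (#(nbh G v) + 1) = Fintype.card V := by exact_mod_cast h2
  linarith

lemma sum_pairLoss_eq (p : ℝ) (C : Igraph V) (v : V) :
    ∑ w, pairLoss p C v w = p * #(nbh (C.labelGraph Colour.blue) v) +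
      (1 - p) * #(nbh (C.labelGraph Colour.red) v) := by
  simp only [pairLoss, sum_add_distrib, ← mul_sum, sum_boole, nbh]
  congr!

/-- A green pair has weight p + (1 - p) = 1, and C_r, C_b are the complements of the blue and the
red graph. The factor 1/2 in `weightOn` accounts for ordered pairs. -/
lemma weight_eq_weightOn_univ (p : ℝ) (C : Igraph V) : C.weight p = weightOn p C univ := by
  have h1 := two_mul_ncard_edgeSet C.redGraph
  have h2 := two_mul_ncard_edgeSet C.blueGraph
  rw [Igraph.redGraph_eq_compl] at h1
  rw [Igraph.blueGraph_eq_compl] at h2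
  simp_rw [card_nbh_compl, sum_sub_distrib, sum_const, nsmul_eq_mul] at h1 h2
  simp only [Igraph.weight, weightOn, sum_pairLoss_eq, sum_add_distrib, ← mul_sum]
  rw [Igraph.redGraph_eq_compl, Igraph.blueGraph_eq_compl]
  rw [card_univ] at h1 h2 ⊢
  linear_combination p / 2 * h1 + (1 - p) / 2 * h2

lemma weight_pullback_subtype (p : ℝ) (C : Igraph V) (s : Finset V) :
    Igraph.weight p (TopEdgeLabeling.pullback C (Function.Embedding.subtype (· ∈ s))) =
      weightOn p C s := by
  rw [weight_eq_weightOn_univ, weightOn, weightOn]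
  simp only [pairLoss_pullback, card_univ, Fintype.card_coe, Function.Embedding.subtype_apply]
  congr 2
  rw [← sum_coe_sort s]
  exact sum_congr rfl fun v _ => sum_coe_sort s _

lemma weight_pullback_equiv [Fintype W] (p : ℝ) (C : Igraph V) (e : W ≃ V) :
    Igraph.weight p (TopEdgeLabeling.pullback C e.toEmbedding) = C.weight p := by
  rw [weight_eq_weightOn_univ, weight_eq_weightOn_univ, weightOn, weightOn]
  simp only [pairLoss_pullback, card_univ, Fintype.card_congr e, Equiv.coe_toEmbedding]
  congr 2
  rw [← Equiv.sum_comp e]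
  exact sum_congr rfl fun v _ => Equiv.sum_comp e _

end Weight
end Translation

/-! ### Turán numbers and the balanced igraphs. -/

section Extremal

open scoped Classical
open Finset

/-- The number of edges of the Turán graph, as a real number. -/
noncomputable def turanEdges (n k : ℕ) : ℝ := (#(turanGraph n k).edgeFinset : ℝ)

lemma two_mul_turanEdges (n k : ℕ) (hk : 0 < k) :
    2 * k * turanEdges n k = (k - 1) * (n : ℝ) ^ 2 - (n % k : ℕ) * (k - (n % k : ℕ)) := by
  induction n using Nat.strong_induction_on with
  | _ n ih =>
    rcases lt_or_ge n k with h | h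
    · have h1 : turanGraph n k = ⊤ := turanGraph_eq_top.2 (.inr h.le)
      have h2 : #(turanGraph n k).edgeFinset = n.choose 2 := by
        have := card_edgeFinset_top_eq_card_choose_two (V := Fin n)
        rw [Fintype.card_fin] at this
        rw [← this]
        congr!
      rw [turanEdges, h2, Nat.cast_choose_two, Nat.mod_eq_of_lt h]
      ring
    · obtain ⟨m, rfl⟩ := Nat.exists_eq_add_of_le' h
      have h1 := ih m (by omega)
      rw [turanEdges, card_edgeFinset_turanGraph_add, Nat.add_mod_right]
      rw [turanEdges] at h1
      push_cast [Nat.cast_choose_two, Nat.cast_sub hk]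
      linear_combination h1

lemma turanEdges_succ_sub (n k : ℕ) (hk : 0 < k) :
    (1 - 1 / k) * (n : ℝ) ≤ turanEdges (n + 1) k - turanEdges n k := by
  have h1 := two_mul_turanEdges n k hk
  have h2 := two_mul_turanEdges (n + 1) k hk
  have hk' : (0 : ℝ) < k := by exact_mod_cast hk
  -- With residue r, the step from r to r + 1 changes r(k - r) by k - 1 - 2r ≤ k - 1; when the
  -- residue wraps to 0 the left side vanishes.
  have hmod : (((n + 1) % k : ℕ) : ℝ) * (k - ((n + 1) % k : ℕ)) ≤
      (n % k : ℕ) * (k - (n % k : ℕ)) + (k - 1) := by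
    have hlt : ((n % k : ℕ) : ℝ) + 1 ≤ k := by exact_mod_cast Nat.mod_lt n hk
    have h0 : (0 : ℝ) ≤ (n % k : ℕ) := by positivity
    rw [Nat.add_mod_eq_ite]
    split_ifs with h
    · have h1k : (1 : ℝ) ≤ k := by linarith
      have : ((n % k + 1 % k - k : ℕ) : ℝ) = 0 := by
        have := Nat.mod_lt n hk
        have := Nat.mod_le 1 k
        rw [Nat.cast_eq_zero]; omega
      rw [this]
      nlinarith
    · rcases Nat.lt_or_ge 1 k with h1k | h1k
      · rw [Nat.mod_eq_of_lt h1k]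
        push_cast
        nlinarith
      · obtain rfl : k = 1 := by omega
        simp [Nat.mod_one]
  push_cast at h2
  have h3 : (2 * k) * ((1 - 1 / k) * (n : ℝ)) ≤
      (2 * k) * (turanEdges (n + 1) k - turanEdges n k) := by
    have e : (2 * k) * ((1 - 1 / k) * (n : ℝ)) = 2 * ((k - 1) * n) := by field_simp
    rw [e]
    nlinarith
  exact le_of_mul_le_mul_left h3 (by positivity)

/-- A graph without a clique of `k + 1` vertices has at most as many edges as the Turán graph. -/
theorem ncard_edgeSet_le_turanEdges {V : Type*} [Fintype V] {G : SimpleGraph V} {k : ℕ}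
    (hk : 0 < k) (h : G.CliqueFree (k + 1)) :
    (G.edgeSet.ncard : ℝ) ≤ turanEdges (Fintype.card V) k ∧
      ((G.edgeSet.ncard : ℝ) = turanEdges (Fintype.card V) k →
        Nonempty (G ≃g turanGraph (Fintype.card V) k)) := by
  obtain ⟨J, _, hJ⟩ := exists_isTuranMaximal (V := V) hk
  obtain ⟨g⟩ := hJ.nonempty_iso_turanGraph
  have hJc : #J.edgeFinset = #(turanGraph (Fintype.card V) k).edgeFinset := g.card_edgeFinset_eq
  have hGc : G.edgeSet.ncard = #G.edgeFinset := Set.ncard_eq_toFinset_card' _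
  rw [turanEdges, ← hJc, hGc]
  refine ⟨by exact_mod_cast hJ.2 h, fun heq => ?_⟩
  have hG : G.IsTuranMaximal k := ⟨h, fun G' _ hG' => by
    have h1 := hJ.2 hG'
    have h2 : #G.edgeFinset = #J.edgeFinset := by exact_mod_cast heq
    omega⟩
  exact hG.nonempty_iso_turanGraph

/-- The weight of `n` vertices split evenly into `k` cliques joined by green edges, when the pairs
inside the cliques have weight `p` and `p + q = 1`. -/
noncomputable def balancedWeight (p q : ℝ) (k n : ℕ) : ℝ := p * (n * (n - 1) / 2) + q * turanEdges n k

lemma balancedWeight_zero (p q : ℝ) (k : ℕ) : balancedWeight p q k 0 = 0 := by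
  have : #(turanGraph 0 k).edgeFinset = 0 := by
    rw [card_eq_zero, edgeFinset_eq_empty]
    exact Subsingleton.elim _ _
  simp [balancedWeight, turanEdges, this]

lemma balancedWeight_succ_sub {p q : ℝ} (hq : 0 ≤ q) (hpq : p + q = 1) {k : ℕ} (hk : 0 < k)
    (n : ℕ) :
    (1 - q / k) * (n : ℝ) ≤ balancedWeight p q k (n + 1) - balancedWeight p q k n := by
  have h := mul_le_mul_of_nonneg_left (turanEdges_succ_sub n k hk) hq
  have e : (1 - q / k) * (n : ℝ) = p * n + q * ((1 - 1 / k) * n) := by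
    linear_combination (-n : ℝ) * hpq
  rw [e]
  simp only [balancedWeight]
  push_cast
  linarith

/-- Separates quadratic, linear and bounded terms, so that two families can be compared by the
quadratic term and, in a tie, by the linear one. -/
lemma balancedWeight_eq {p q : ℝ} (hpq : p + q = 1) {k : ℕ} (hk : 0 < k) (n : ℕ) :
    balancedWeight p q k n = (1 - q / k) * (n : ℝ) ^ 2 / 2 - p * n / 2 -
      q * ((n % k : ℕ) * (k - (n % k : ℕ))) / (2 * k) := by
  have h := two_mul_turanEdges n k hk
  have hk' : (0 : ℝ) < k := by exact_mod_cast hk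
  have h2 : turanEdges n k =
      ((k - 1) * (n : ℝ) ^ 2 - (n % k : ℕ) * (k - (n % k : ℕ))) / (2 * k) := by
    rw [eq_div_iff (by positivity)]; linarith
  obtain rfl : p = 1 - q := by linarith
  rw [balancedWeight, h2]
  field_simp
  ring

lemma exists_balancedWeight_lt {p q : ℝ} (hp : 0 ≤ p) (hq : 0 ≤ q) (hpq : p + q = 1) {a k : ℕ}
    (ha : 0 < a) (hk : 0 < k) (h : q / k < p / a ∨ (q / k = p / a ∧ p < q)) :
    ∃ n₁ : ℕ, ∀ n ≥ n₁, balancedWeight q p a n < balancedWeight p q k n := by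
  have ha' : (0 : ℝ) < a := by exact_mod_cast ha
  have hk' : (0 : ℝ) < k := by exact_mod_cast hk
  have hle : ∀ n : ℕ, (p / a - q / k) * (n : ℝ) ^ 2 + (q - p) * n - k ≤
      2 * (balancedWeight p q k n - balancedWeight q p a n) := by
    intro n
    rw [balancedWeight_eq hpq hk, balancedWeight_eq (by linarith : q + p = 1) ha]
    have h1 : 0 ≤ p * ((n % a : ℕ) * (a - (n % a : ℕ))) / (2 * a) := by
      have : ((n % a : ℕ) : ℝ) ≤ a := by exact_mod_cast (Nat.mod_lt n ha).le
      have : 0 ≤ (a : ℝ) - (n % a : ℕ) := by linarith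
      positivity
    have h2 : q * ((n % k : ℕ) * (k - (n % k : ℕ))) / (2 * k) ≤ k / 2 := by
      have h3 : ((n % k : ℕ) : ℝ) ≤ k := by exact_mod_cast (Nat.mod_lt n hk).le
      have h4 : (0 : ℝ) ≤ (n % k : ℕ) := by positivity
      have h5 : ((n % k : ℕ) : ℝ) * (k - (n % k : ℕ)) ≤ k * k :=
        mul_le_mul h3 (by linarith) (by linarith) hk'.le
      have h6 : q * ((n % k : ℕ) * (k - (n % k : ℕ))) ≤ 1 * (k * k) :=
        mul_le_mul (by linarith) h5 (mul_nonneg h4 (by linarith)) zero_le_one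
      rw [div_le_iff₀ (by positivity)]
      linarith
    linarith
  rcases h with h | ⟨h, hlt⟩
  · obtain ⟨n₁, hn₁⟩ := exists_nat_gt ((1 + k) / (p / a - q / k))
    refine ⟨n₁ + 1, fun n hn => ?_⟩
    have hd : 0 < p / a - q / k := by linarith
    rw [div_lt_iff₀ hd] at hn₁
    have hn' : (n₁ : ℝ) + 1 ≤ n := by exact_mod_cast hn
    have hn0 : (0 : ℝ) ≤ n₁ := by positivity
    have := hle n
    have h1 : (1 + k : ℝ) < (p / a - q / k) * n := by nlinarith
    have h2 : (1 + k : ℝ) * n ≤ (p / a - q / k) * n * n := by gcongr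
    have h3 : -1 * (n : ℝ) ≤ (q - p) * n := by gcongr; linarith
    nlinarith
  · obtain ⟨n₁, hn₁⟩ := exists_nat_gt (k / (q - p))
    refine ⟨n₁, fun n hn => ?_⟩
    have hd : 0 < q - p := by linarith
    rw [div_lt_iff₀ hd] at hn₁
    have hn' : (n₁ : ℝ) ≤ n := by exact_mod_cast hn
    have := hle n
    rw [h, sub_self, zero_mul, zero_add] at this
    nlinarith

lemma card_edgeSet_le {V : Type*} [Fintype V] (G : SimpleGraph V) :
    (G.edgeSet.ncard : ℝ) ≤ Fintype.card V * (Fintype.card V - 1) / 2 ∧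
      ((G.edgeSet.ncard : ℝ) = Fintype.card V * (Fintype.card V - 1) / 2 → G = ⊤) := by
  have htop : ((⊤ : SimpleGraph V).edgeSet.ncard : ℝ) =
      Fintype.card V * (Fintype.card V - 1) / 2 := by
    rw [← Nat.cast_choose_two, ← card_edgeFinset_top_eq_card_choose_two,
      Set.ncard_eq_toFinset_card']
    rfl
  rw [← htop]
  have hsub : G.edgeSet ⊆ (⊤ : SimpleGraph V).edgeSet := edgeSet_mono le_top
  refine ⟨by exact_mod_cast Set.ncard_le_ncard hsub (Set.toFinite _), fun h => ?_⟩
  have := Set.eq_of_subset_of_ncard_le hsub (by exact_mod_cast h.ge) (Set.toFinite _)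
  exact edgeSet_injective this

namespace Igraph

section Bounds

variable {V : Type*} [Fintype V] {p : ℝ} {k : ℕ}

/-- The two terms of the weight are bounded separately, C_r by the complete graph and C_b by Turán's
theorem. Both coefficients are positive, so equality forces equality in each. -/
lemma weight_le_of_blueGraph_cliqueFree (hp : 0 < p) (hp1 : p < 1) (hk : 0 < k) {C : Igraph V}
    (h : C.blueGraph.CliqueFree (k + 1)) :
    C.weight p ≤ balancedWeight p (1 - p) k (Fintype.card V) ∧
      (C.weight p = balancedWeight p (1 - p) k (Fintype.card V) →
        C.redGraph = ⊤ ∧ Nonempty (C.blueGraph ≃g turanGraph (Fintype.card V) k)) := by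
  obtain ⟨h1, h1'⟩ := ncard_edgeSet_le_turanEdges hk h
  obtain ⟨h2, h2'⟩ := card_edgeSet_le C.redGraph
  have hq : 0 < 1 - p := by linarith
  have h3 := mul_le_mul_of_nonneg_left h1 hq.le
  have h4 := mul_le_mul_of_nonneg_left h2 hp.le
  rw [weight, balancedWeight]
  refine ⟨by linarith, fun heq => ⟨h2' ?_, h1' ?_⟩⟩
  · exact mul_left_cancel₀ hp.ne' (by linarith)
  · exact mul_left_cancel₀ hq.ne' (by linarith)

lemma weight_le_of_redGraph_cliqueFree (hp : 0 < p) (hp1 : p < 1) (hk : 0 < k) {C : Igraph V}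
    (h : C.redGraph.CliqueFree (k + 1)) :
    C.weight p ≤ balancedWeight (1 - p) p k (Fintype.card V) ∧
      (C.weight p = balancedWeight (1 - p) p k (Fintype.card V) →
        C.blueGraph = ⊤ ∧ Nonempty (C.redGraph ≃g turanGraph (Fintype.card V) k)) := by
  obtain ⟨h1, h1'⟩ := ncard_edgeSet_le_turanEdges hk h
  obtain ⟨h2, h2'⟩ := card_edgeSet_le C.blueGraph
  have hq : 0 < 1 - p := by linarith
  have h3 := mul_le_mul_of_nonneg_left h1 hp.le
  have h4 := mul_le_mul_of_nonneg_left h2 hq.le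
  rw [weight, balancedWeight]
  refine ⟨by linarith, fun heq => ⟨h2' ?_, h1' ?_⟩⟩
  · exact mul_left_cancel₀ hq.ne' (by linarith)
  · exact mul_left_cancel₀ hp.ne' (by linarith)

end Bounds

section Balanced

variable {p : ℝ} {k n : ℕ}

lemma balanced_get (c : Colour) (x y : Fin n) (h : x ≠ y) :
    EdgeLabeling.get (balanced c k n) x y h =
      if (x : ℕ) % k = (y : ℕ) % k then c else Colour.green := rfl

lemma balancedRed_redGraph : (balancedRed k n).redGraph = ⊤ := by
  ext x y
  simp only [redGraph_eq_compl, compl_adj, TopEdgeLabeling.labelGraph_adj, balancedRed,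
    balanced_get, top_adj]
  constructor
  · exact fun h => h.1
  · refine fun h => ⟨h, ?_⟩
    rintro ⟨_, h'⟩
    split_ifs at h'

lemma balancedRed_blueGraph : (balancedRed k n).blueGraph = turanGraph n k := by
  ext x y
  simp only [blueGraph_eq_compl, compl_adj, TopEdgeLabeling.labelGraph_adj, balancedRed,
    balanced_get, turanGraph_adj]
  by_cases h : x = y
  · simp [h]
  · by_cases h' : (x : ℕ) % k = (y : ℕ) % k <;> simp [h, h']

lemma balancedBlue_blueGraph : (balancedBlue k n).blueGraph = ⊤ := by
  ext x y
  simp only [blueGraph_eq_compl, compl_adj, TopEdgeLabeling.labelGraph_adj, balancedBlue,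
    balanced_get, top_adj]
  constructor
  · exact fun h => h.1
  · refine fun h => ⟨h, ?_⟩
    rintro ⟨_, h'⟩
    split_ifs at h'

lemma balancedBlue_redGraph : (balancedBlue k n).redGraph = turanGraph n k := by
  ext x y
  simp only [redGraph_eq_compl, compl_adj, TopEdgeLabeling.labelGraph_adj, balancedBlue,
    balanced_get, turanGraph_adj]
  by_cases h : x = y
  · simp [h]
  · by_cases h' : (x : ℕ) % k = (y : ℕ) % k <;> simp [h, h']

lemma ncard_edgeSet_top_fin (n : ℕ) :
    ((⊤ : SimpleGraph (Fin n)).edgeSet.ncard : ℝ) = n * (n - 1) / 2 := by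
  rw [← Nat.cast_choose_two, Set.ncard_eq_toFinset_card']
  have := card_edgeFinset_top_eq_card_choose_two (V := Fin n)
  rw [Fintype.card_fin] at this
  exact_mod_cast this

lemma ncard_edgeSet_turanGraph (n k : ℕ) :
    ((turanGraph n k).edgeSet.ncard : ℝ) = turanEdges n k := by
  rw [turanEdges, Set.ncard_eq_toFinset_card']
  rfl

lemma weight_balancedRed : (balancedRed k n).weight p = balancedWeight p (1 - p) k n := by
  rw [weight, balancedRed_redGraph, balancedRed_blueGraph, ncard_edgeSet_top_fin,
    ncard_edgeSet_turanGraph, balancedWeight]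

lemma weight_balancedBlue : (balancedBlue k n).weight p = balancedWeight (1 - p) p k n := by
  rw [weight, balancedBlue_redGraph, balancedBlue_blueGraph, ncard_edgeSet_top_fin,
    ncard_edgeSet_turanGraph, balancedWeight, add_comm]

/-- When C_r is complete no pair is blue, so C_b determines the colouring: its edges are green and
all other pairs red. -/
lemma isIsomorphic_balancedRed {C : Igraph (Fin n)} (hr : C.redGraph = ⊤)
    (e : C.blueGraph ≃g turanGraph n k) : C.IsIsomorphic (balancedRed k n) := by
  refine ⟨e.toEquiv, EdgeLabeling.ext_get fun x y h => ?_⟩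
  have h1 : C.redGraph.Adj x y := by rw [hr]; exact h
  have h2 := e.map_adj_iff (v := x) (w := y)
  have h3 : C.blueGraph.Adj x y ↔ x ≠ y ∧ ¬ ∃ H : x ≠ y, EdgeLabeling.get C x y H = Colour.red := by
    rw [blueGraph_eq_compl, compl_adj, TopEdgeLabeling.labelGraph_adj]
  rw [turanGraph_adj] at h2
  replace h2 := h2.trans h3
  rw [redGraph_eq_compl, compl_adj, TopEdgeLabeling.labelGraph_adj] at h1
  change (if (e x : ℕ) % k = (e y : ℕ) % k then Colour.red else Colour.green) = _
  have hne : x ≠ y := h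
  cases hc : EdgeLabeling.get C x y h <;> simp_all

lemma isIsomorphic_balancedBlue {C : Igraph (Fin n)} (hr : C.blueGraph = ⊤)
    (e : C.redGraph ≃g turanGraph n k) : C.IsIsomorphic (balancedBlue k n) := by
  refine ⟨e.toEquiv, EdgeLabeling.ext_get fun x y h => ?_⟩
  have h1 : C.blueGraph.Adj x y := by rw [hr]; exact h
  have h2 := e.map_adj_iff (v := x) (w := y)
  have h3 : C.redGraph.Adj x y ↔ x ≠ y ∧ ¬ ∃ H : x ≠ y, EdgeLabeling.get C x y H = Colour.blue := by
    rw [redGraph_eq_compl, compl_adj, TopEdgeLabeling.labelGraph_adj]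
  rw [turanGraph_adj] at h2
  replace h2 := h2.trans h3
  rw [blueGraph_eq_compl, compl_adj, TopEdgeLabeling.labelGraph_adj] at h1
  change (if (e x : ℕ) % k = (e y : ℕ) % k then Colour.blue else Colour.green) = _
  have hne : x ≠ y := h
  cases hc : EdgeLabeling.get C x y h <;> simp_all

lemma balancedRed_isFree {a : ℕ} (hk : 0 < k) :
    (balancedRed k n).IsFree (eyeGraph a (k + 1)) :=
  isFree_of_blueGraph_cliqueFree (by rw [balancedRed_blueGraph]; exact turanGraph_cliqueFree hk)

lemma balancedBlue_isFree {b : ℕ} (hk : 0 < k) (hb : 1 ≤ b) :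
    (balancedBlue k n).IsFree (eyeGraph k b) :=
  isFree_of_redGraph_cliqueFree hb (by rw [balancedBlue_redGraph]; exact turanGraph_cliqueFree hk)

lemma IsIsomorphic.weight_eq {C D : Igraph (Fin n)} (h : C.IsIsomorphic D) :
    C.weight p = D.weight p := by
  obtain ⟨e, rfl⟩ := h
  exact weight_pullback_equiv p D e

lemma IsIsomorphic.isFree {W : Type*} {H : SimpleGraph W} {C D : Igraph (Fin n)}
    (h : C.IsIsomorphic D) (hD : D.IsFree H) : C.IsFree H := by
  obtain ⟨e, rfl⟩ := h
  exact hD.pullback _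

end Balanced

end Igraph

end Extremal

/-! ### From the degree condition to all eye-free igraphs. -/

section Stability

open scoped Classical
open Finset

/-- An igraph that is at least as heavy as the extremal ones has no red and green `K_{a+1}` or no
blue and green `K_b`, and is not heavier. -/
theorem exists_forall_isFree_weight_le {a b : ℕ} (ha : 2 ≤ a) (hb : 2 ≤ b) {p l : ℝ} (hp : 0 < p)
    (hp1 : p < 1) (hl : 0 ≤ l) (hla : l ≤ p / a) (hlb : l ≤ (1 - p) / (b - 1)) (f : ℕ → ℝ)
    (hf₀ : f 0 = 0) (hf : ∀ n : ℕ, (1 - l) * (n : ℝ) ≤ f (n + 1) - f n) (n₁ : ℕ)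
    (hfr : ∀ n ≥ n₁, balancedWeight p (1 - p) (b - 1) n ≤ f n)
    (hfb : ∀ n ≥ n₁, balancedWeight (1 - p) p a n ≤ f n) :
    ∃ n₀ : ℕ, ∀ n ≥ n₀, ∀ C : Igraph (Fin n), C.IsFree (eyeGraph a b) → f n ≤ C.weight p →
      C.weight p ≤ f n ∧ (C.redGraph.CliqueFree (a + 1) ∨ C.blueGraph.CliqueFree b) := by
  have hq : 0 < 1 - p := by linarith
  obtain ⟨ε, hε, N, hkey⟩ :=
    exists_forall_eyeFree_not_indep ha hb hp hq hp1.le hl hla hlb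
  set M := max N n₁ with hM
  -- The penalty grows by (1 - l - ε) m, slightly slower than `f`. A maximiser of weight minus `g`
  -- therefore has no vertex of large loss, while f - g still favours large sets.
  set g : ℕ → ℝ := fun m => (1 - l - ε) * (m * (m - 1) / 2) with hg
  have hmono : StrictMonoOn (fun m => f m - g m) (Set.Ici 1) := by
    refine strictMonoOn_of_lt_add_one Set.ordConnected_Ici fun m _ hm _ => ?_
    have h1 := hf m
    have hm0 : (0 : ℝ) < m := by exact_mod_cast hm
    have h2 : g (m + 1) - g m = (1 - l - ε) * m := by simp only [hg]; push_cast; ring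
    have : 0 < ε * m := by positivity
    linarith
  have hflow : ∀ m : ℕ, (1 - l) * (m * (m - 1) / 2) ≤ f m := by
    intro m
    induction m with
    | zero => simp [hf₀]
    | succ m ih =>
      have h1 := hf m
      push_cast
      linarith
  obtain ⟨n₀, hn₀⟩ := exists_nat_gt ((l + ε) * M ^ 2 / ε + 2)
  refine ⟨n₀, fun n hn C hC hw => ?_⟩
  have hnR : (n₀ : ℝ) ≤ n := by exact_mod_cast hn
  have hn2 : (2 : ℝ) ≤ n := by
    have : 0 ≤ (l + ε) * M ^ 2 / ε := by positivity
    linarith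
  obtain ⟨s, -, hs⟩ := exists_max_image (univ : Finset (Finset (Fin n)))
    (fun s => weightOn p C s - g #s) ⟨∅, mem_univ _⟩
  have hsdeg : ∀ v ∈ s, ∑ w ∈ s, pairLoss p C v w ≤ (l + ε) * #s := by
    intro v hv
    have h1 := hs (s.erase v) (mem_univ _)
    have h2 := weightOn_sub_weightOn_erase p C s hv
    have hpos : 1 ≤ #s := card_pos.2 ⟨v, hv⟩
    simp only [hg, card_erase_of_mem hv, Nat.cast_sub hpos, Nat.cast_one] at h1
    have e : (1 - l - ε) * (#s * (#s - 1) / 2) - (1 - l - ε) * ((#s - 1) * (#s - 1 - 1) / 2) =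
        (#s - 1) - (l + ε) * #s + (l + ε) := by ring
    linarith
  have hsuniv : f n - g n ≤ weightOn p C s - g #s := by
    have h1 := hs univ (mem_univ _)
    rw [card_univ, Fintype.card_fin, ← weight_eq_weightOn_univ] at h1
    linarith
  have hsW : weightOn p C s ≤ #s * (#s - 1) / 2 := by
    have : 0 ≤ ∑ v ∈ s, ∑ w ∈ s, pairLoss p C v w :=
      sum_nonneg fun v _ => sum_nonneg fun w _ => pairLoss_nonneg hp.le hp1.le C v w
    rw [weightOn]
    linarith
  -- The value at the full set is at least ε n(n-1)/2, whereas a set of size below `M` reaches at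
  -- most (l + ε) M²/2.
  have hsM : M ≤ #s := by
    by_contra! hlt
    have h1 := hflow n
    have h2 : ε * (n * (n - 1)) ≤ (l + ε) * (#s * (#s - 1)) := by
      simp only [hg] at hsuniv
      linarith
    have h3 : (#s : ℝ) * (#s - 1) ≤ M ^ 2 := by
      have : (#s : ℝ) ≤ M := by exact_mod_cast hlt.le
      nlinarith
    have h4 : (l + ε) * (#s * (#s - 1)) ≤ (l + ε) * M ^ 2 := by gcongr
    have h5 : (l + ε) * M ^ 2 / ε < n := by linarith
    rw [div_lt_iff₀ hε] at h5
    have h6 : ε * n ≤ ε * (n * (n - 1)) := by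
      gcongr
      nlinarith
    linarith
  set D : Igraph s := TopEdgeLabeling.pullback C (Function.Embedding.subtype (· ∈ s)) with hD
  have hDw : D.weight p = weightOn p C s := weight_pullback_subtype p C s
  have hDfree : D.IsFree (eyeGraph a b) := hC.pullback _
  have hDdeg : ∀ v, (1 - p) * #(nbh (D.labelGraph Colour.red) v) +
      p * #(nbh (D.labelGraph Colour.blue) v) ≤ (l + ε) * Fintype.card s := by
    intro v
    rw [add_comm, ← sum_pairLoss_eq, Fintype.card_coe]
    simp only [hD, pairLoss_pullback, Function.Embedding.subtype_apply]
    rw [sum_coe_sort s (fun w => pairLoss p C v w)]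
    exact hsdeg v v.2
  have hb1 : 0 < b - 1 := by omega
  have hb2 : b - 1 + 1 = b := by omega
  have hsf : weightOn p C s ≤ f #s := by
    rw [← hDw]
    rcases hkey s _ _ (by rw [Fintype.card_coe]; exact (le_max_left _ _).trans hsM)
      (EdgeLabeling.pairwise_disjoint_labelGraph (by simp)) hDfree.eyeFree hDdeg with h | h
    · have h' : D.redGraph.CliqueFree (a + 1) := by
        rw [Igraph.redGraph_eq_compl]; exact cliqueFree_compl_of_forall_not_indep h
      have := (Igraph.weight_le_of_redGraph_cliqueFree hp hp1 (by omega) h').1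
      rw [Fintype.card_coe] at this
      exact this.trans (hfb _ ((le_max_right _ _).trans hsM))
    · have h' : D.blueGraph.CliqueFree (b - 1 + 1) := by
        rw [Igraph.blueGraph_eq_compl, hb2]; exact cliqueFree_compl_of_forall_not_indep h
      have := (Igraph.weight_le_of_blueGraph_cliqueFree hp hp1 hb1 h').1
      rw [Fintype.card_coe] at this
      exact this.trans (hfr _ ((le_max_right _ _).trans hsM))
  have hsn : #s ≤ n := by simpa using card_le_univ s
  have hs_univ : s = univ := by
    rw [← card_eq_iff_eq_univ, Fintype.card_fin]
    by_contra hne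
    have hlt : #s < n := lt_of_le_of_ne hsn hne
    -- The growth bound gives no strict increase of f - g from 0 to 1, so the empty set is excluded
    -- separately.
    rcases Nat.eq_zero_or_pos #s with h0 | hpos
    · have h1 : #s = 0 := h0
      have h2 := hflow n
      rw [card_eq_zero] at h0
      simp only [hg, h0, weightOn, card_empty, sum_empty] at hsuniv
      have : 0 < ε * (n * (n - 1)) := by
        have : (0 : ℝ) < n * (n - 1) := mul_pos (by linarith) (by linarith)
        positivity
      norm_num at hsuniv
      linarith
    · have := hmono (Set.mem_Ici.2 hpos) (Set.mem_Ici.2 ((Nat.succ_le_of_lt hpos).trans hlt.le)) hlt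
      simp only at this
      linarith
  subst hs_univ
  refine ⟨?_, ?_⟩
  · rw [← weight_eq_weightOn_univ, card_univ, Fintype.card_fin] at hsf
    exact hsf
  · refine (hkey (Fin n) _ _ ?_ (EdgeLabeling.pairwise_disjoint_labelGraph (by simp)) hC.eyeFree
      fun v => ?_).imp (fun h => ?_) fun h => ?_
    · rw [← card_univ]; exact (le_max_left _ _).trans hsM
    · rw [add_comm, ← sum_pairLoss_eq, ← card_univ]
      exact hsdeg v (mem_univ v)
    · rw [Igraph.redGraph_eq_compl]; exact cliqueFree_compl_of_forall_not_indep h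
    · rw [Igraph.blueGraph_eq_compl]; exact cliqueFree_compl_of_forall_not_indep h

namespace Igraph

variable {a b n : ℕ} {p w : ℝ}

lemma isExtremal_of_weight_eq {W : Type*} {H : SimpleGraph W} {C : Igraph (Fin n)}
    (hmax : ∀ D : Igraph (Fin n), D.IsFree H → w ≤ D.weight p → D.weight p ≤ w)
    (hC : C.IsFree H) (hw : C.weight p = w) : C.IsExtremal p H := by
  refine ⟨hC, fun D hD => ?_⟩
  rw [hw]
  rcases le_total w (D.weight p) with h | h
  · exact hmax D hD h
  · exact h

/-- If both balanced igraphs are compared with the maximal weight `w`, the extremal igraphs are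
exactly those balanced ones that attain it. -/
theorem isExtremal_iff (ha : 2 ≤ a) (hb : 2 ≤ b) (hp : 0 < p) (hp1 : p < 1)
    (hmax : ∀ C : Igraph (Fin n), C.IsFree (eyeGraph a b) → w ≤ C.weight p →
      C.weight p ≤ w ∧ (C.redGraph.CliqueFree (a + 1) ∨ C.blueGraph.CliqueFree b))
    (hw : w = max (balancedWeight p (1 - p) (b - 1) n) (balancedWeight (1 - p) p a n))
    (C : Igraph (Fin n)) :
    C.IsExtremal p (eyeGraph a b) ↔
      (C.IsIsomorphic (balancedRed (b - 1) n) ∧ balancedWeight p (1 - p) (b - 1) n = w) ∨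
      (C.IsIsomorphic (balancedBlue a n) ∧ balancedWeight (1 - p) p a n = w) := by
  have hb1 : 0 < b - 1 := by omega
  have hb2 : b - 1 + 1 = b := by omega
  have hR : (balancedRed (b - 1) n).IsFree (eyeGraph a b) := by
    have := balancedRed_isFree (n := n) (a := a) hb1
    rwa [hb2] at this
  have hB : (balancedBlue a n).IsFree (eyeGraph a b) := balancedBlue_isFree (by omega) (by omega)
  constructor
  · rintro ⟨hC, hCmax⟩
    have hle : w ≤ C.weight p := by
      rw [hw, max_le_iff, ← weight_balancedRed, ← weight_balancedBlue]
      exact ⟨hCmax _ hR, hCmax _ hB⟩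
    obtain ⟨hge, h | h⟩ := hmax C hC hle
    · right
      obtain ⟨h1, h2⟩ := weight_le_of_redGraph_cliqueFree hp hp1 (by omega) h
      rw [Fintype.card_fin] at h1 h2
      have heq : balancedWeight (1 - p) p a n = w :=
        le_antisymm (hw ▸ le_max_right _ _) (hle.trans h1)
      obtain ⟨h3, ⟨e⟩⟩ := h2 (by rw [heq]; exact le_antisymm hge hle)
      exact ⟨isIsomorphic_balancedBlue h3 e, heq⟩
    · left
      obtain ⟨h1, h2⟩ := weight_le_of_blueGraph_cliqueFree hp hp1 hb1 (hb2.symm ▸ h)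
      rw [Fintype.card_fin] at h1 h2
      have heq : balancedWeight p (1 - p) (b - 1) n = w :=
        le_antisymm (hw ▸ le_max_left _ _) (hle.trans h1)
      obtain ⟨h3, ⟨e⟩⟩ := h2 (by rw [heq]; exact le_antisymm hge hle)
      exact ⟨isIsomorphic_balancedRed h3 e, heq⟩
  · rintro (⟨h, heq⟩ | ⟨h, heq⟩)
    · exact isExtremal_of_weight_eq (fun D hD hDw => (hmax D hD hDw).1) (h.isFree hR)
        (by rw [h.weight_eq, weight_balancedRed, heq])
    · exact isExtremal_of_weight_eq (fun D hD hDw => (hmax D hD hDw).1) (h.isFree hB)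
        (by rw [h.weight_eq, weight_balancedBlue, heq])

end Igraph

/-- The weighted density lost in the red and in the blue balanced igraphs, compared through the
threshold for `p`. -/
lemma div_lt_div_iff_threshold {a k : ℝ} (ha : 0 < a) (hk : 0 < k) (p : ℝ) :
    ((1 - p) / k < p / a ↔ a / (a + k) < p) ∧ (p / a < (1 - p) / k ↔ p < a / (a + k)) := by
  rw [div_lt_div_iff₀ hk ha, div_lt_div_iff₀ ha hk, div_lt_iff₀ (by positivity),
    lt_div_iff₀ (by positivity)]
  constructor <;> constructor <;> intro h <;> linarith

end Stability

theorem theorem1p3 (a b : ℕ) (ha : 2 ≤ a) (hb : 2 ≤ b) (p : ℝ) (hp₀ : 0 < p) (hp₁ : p < 1) :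
    ∃ n₀ : ℕ, ∀ n : ℕ, n₀ < n →
      ((p > (a : ℝ) / (a + b - 1) ∨ (p = (a : ℝ) / (a + b - 1) ∧ (a : ℝ) < b - 1)) →
        ∀ C : Igraph (Fin n), C.IsExtremal p (eyeGraph a b) ↔
          C.IsIsomorphic (Igraph.balancedRed (b - 1) n)) ∧
      ((p < (a : ℝ) / (a + b - 1) ∨ (p = (a : ℝ) / (a + b - 1) ∧ (a : ℝ) > b - 1)) →
        ∀ C : Igraph (Fin n), C.IsExtremal p (eyeGraph a b) ↔
          C.IsIsomorphic (Igraph.balancedBlue a n)) ∧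
      ((p = (a : ℝ) / (a + b - 1) ∧ (a : ℝ) / (a + b - 1) = 1 / 2) →
        ∀ C : Igraph (Fin n), C.IsExtremal p (eyeGraph a b) ↔
          (C.IsIsomorphic (Igraph.balancedRed (b - 1) n) ∨
            C.IsIsomorphic (Igraph.balancedBlue a n))) := by
  have ha0 : (0 : ℝ) < a := by positivity
  have hb2 : (2 : ℝ) ≤ b := by exact_mod_cast hb
  have hcast : ((b - 1 : ℕ) : ℝ) = b - 1 := by rw [Nat.cast_sub (by omega), Nat.cast_one]
  set k : ℝ := (b : ℝ) - 1 with hk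
  have hk0 : 0 < k := by linarith
  have hb1 : 0 < b - 1 := by omega
  have hq : 0 < 1 - p := by linarith
  have hak : (a : ℝ) + b - 1 = a + k := by rw [hk]; ring
  rw [hak]
  obtain ⟨hlt, hgt⟩ := div_lt_div_iff_threshold ha0 hk0 p
  have heq : p = a / (a + k) → (1 - p) / k = p / a := fun h => by
    rw [div_eq_div_iff hk0.ne' ha0.ne']
    rw [eq_div_iff (by positivity)] at h
    linarith
  have hhalf : p = a / (a + k) → p * (a + k) = a := fun h => by
    rwa [eq_div_iff (by positivity)] at h
  have hfR := balancedWeight_succ_sub (p := p) hq.le (by ring) hb1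
  have hfB := balancedWeight_succ_sub (p := 1 - p) hp₀.le (by ring) (by omega : 0 < a)
  rw [hcast] at hfR
  by_cases hred : p > a / (a + k) ∨ (p = a / (a + k) ∧ (a : ℝ) < k)
  · have hle : (1 - p) / k ≤ p / a := by
      rcases hred with h | ⟨h, -⟩
      · exact (hlt.2 h).le
      · exact (heq h).le
    obtain ⟨n₁, hn₁⟩ := exists_balancedWeight_lt hp₀.le hq.le (by ring) (by omega : 0 < a) hb1 (by
      rw [hcast]
      refine hred.imp hlt.2 fun h => ⟨heq h.1, ?_⟩
      have := hhalf h.1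
      nlinarith)
    obtain ⟨n₀, hn₀⟩ := exists_forall_isFree_weight_le ha hb hp₀ hp₁ (by positivity) hle le_rfl
      (balancedWeight p (1 - p) (b - 1)) (balancedWeight_zero _ _ _) hfR n₁ (fun _ _ => le_rfl)
      (fun n hn => (hn₁ n hn).le)
    refine ⟨max n₀ n₁, fun n hn => ⟨fun _ C => ?_, fun h => ?_, fun h => ?_⟩⟩
    · have h1 := hn₁ n (by omega)
      rw [Igraph.isExtremal_iff ha hb hp₀ hp₁ (hn₀ n (by omega)) (max_eq_left h1.le).symm]
      simp [h1.ne]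
    · rcases hred with h1 | ⟨h1, h2⟩ <;> rcases h with h3 | ⟨h3, h4⟩ <;> linarith
    · rw [h.2] at hred
      have := hhalf h.1
      rcases hred with h1 | ⟨h1, h2⟩
      · linarith [h.1, h.2]
      · rw [h1] at this; linarith
  by_cases hblue : p < a / (a + k) ∨ (p = a / (a + k) ∧ (a : ℝ) > k)
  · have hle : p / a ≤ (1 - p) / k := by
      rcases hblue with h | ⟨h, -⟩
      · exact (hgt.2 h).le
      · exact (heq h).ge
    obtain ⟨n₁, hn₁⟩ := exists_balancedWeight_lt hq.le hp₀.le (by ring) hb1 (by omega : 0 < a) (by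
      rw [hcast]
      refine hblue.imp hgt.2 fun h => ⟨(heq h.1).symm, ?_⟩
      have := hhalf h.1
      nlinarith)
    obtain ⟨n₀, hn₀⟩ := exists_forall_isFree_weight_le ha hb hp₀ hp₁ (by positivity) le_rfl hle
      (balancedWeight (1 - p) p a) (balancedWeight_zero _ _ _) hfB n₁ (fun n hn => (hn₁ n hn).le)
      (fun _ _ => le_rfl)
    refine ⟨max n₀ n₁, fun n hn => ⟨fun h => absurd h hred, fun _ C => ?_, fun h => ?_⟩⟩
    · have h1 := hn₁ n (by omega)
      rw [Igraph.isExtremal_iff ha hb hp₀ hp₁ (hn₀ n (by omega)) (max_eq_right h1.le).symm]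
      simp [h1.ne]
    · rw [h.2] at hblue
      have := hhalf h.1
      rcases hblue with h1 | ⟨h1, h2⟩
      · linarith [h.1, h.2]
      · rw [h1] at this; linarith
  have hpe : p = a / (a + k) := by
    rw [not_or] at hred hblue
    linarith [not_lt.1 hred.1, not_lt.1 hblue.1]
  have hak' : (a : ℝ) = k := by
    rw [not_or] at hred hblue
    have h1 : ¬ (a : ℝ) < k := fun h => hred.2 ⟨hpe, h⟩
    have h2 : ¬ (a : ℝ) > k := fun h => hblue.2 ⟨hpe, h⟩
    linarith [not_lt.1 h1, not_lt.1 h2]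
  have hab : b - 1 = a := by
    have : ((b - 1 : ℕ) : ℝ) = a := by rw [hcast, hak']
    exact_mod_cast this
  have hp2 : 1 - p = p := by
    have := hhalf hpe
    rw [← hak'] at this
    nlinarith
  -- In the remaining case b - 1 = a and p = 1/2, so the two weights agree for every n and both
  -- families are extremal.
  have hWeq : balancedWeight (1 - p) p a = balancedWeight p (1 - p) (b - 1) := by rw [hab, hp2]
  obtain ⟨n₀, hn₀⟩ := exists_forall_isFree_weight_le ha hb hp₀ hp₁ (by positivity) (heq hpe).le
    le_rfl (balancedWeight p (1 - p) (b - 1)) (balancedWeight_zero _ _ _) hfR 0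
    (fun _ _ => le_rfl) (fun n _ => by rw [hWeq])
  refine ⟨n₀, fun n hn => ⟨fun h => absurd h hred, fun h => absurd h hblue, fun _ C => ?_⟩⟩
  rw [Igraph.isExtremal_iff ha hb hp₀ hp₁ (hn₀ n hn.le) (by rw [hWeq, max_self])]
  simp [hWeq]
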